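/- Let $G$ be a (real, finite-dimensional, smooth, Hausdorff) Lie group with Lie algebra $\mathfrak g$, let $U\in\mathfrak g$ with $U\neq 0$, and let $\psi(s)=\exp(sU)$, $s\in\mathbb{R}$. Then $\psi:\mathbb{R}\to G$ is a homomorphism, $\psi(\mathbb{R})$ is a connected abelian subgroup of $G$, and exactly one of the following three cases holds: 1) $\psi(\mathbb{R})$ is a closed subgroup of $G$, and $\psi$ is a diffeomorphism (hence an isomorphism of Lie groups) from $\mathbb{R}$ onto the embedded submanifold $\psi(\mathbb{R})$; 2) $\psi(\mathbb{R})$ is a closed subgroup of $G$, it is an embedded Lie subgroup isomorphic (in particular diffeomorphic) to the circle $S^1$, and $\psi:\mathbb{R}\to\psi(\mathbb{R})$ is a smooth covering map; 3) $\psi(\mathbb{R})$ is not a closed subgroup of $G$, and its closure is an embedded Lie subgroup of $G$ isomorphic to a torus $T^k=(S^1)^k$ of dimension $k\geq 2$. -/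

import Mathlib

open scoped Manifold ContDiff

noncomputable section

variable {E : Type*} [NormedAddCommGroup E] [NormedSpace ℝ E]
  {H : Type*} [TopologicalSpace H] (I : ModelWithCorners ℝ E H)
  {G : Type*} [TopologicalSpace G] [ChartedSpace H G] [Group G]

open Classical in
/-- The exponential map of a Lie group `G`: `exp U = γ 1`, where `γ : ℝ → G` is the integral curve,
with `γ 0 = 1`, of the left-invariant vector field on `G` whose value at `1` is `U`.
(On a Lie group such a curve exists and is unique, so the default value is never used.) -/
def lieExp (U : GroupLieAlgebra I G) : G :=
  if h : ∃ γ : ℝ → G, γ 0 = 1 ∧ IsMIntegralCurve γ (mulInvariantVectorField (I := I) (G := G) U)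
  then h.choose 1 else 1

/-- The one-parameter group `s ↦ exp (s U)`. -/
def oneParam (U : GroupLieAlgebra I G) (s : ℝ) : G :=
  lieExp I (s • U)

/-- The image of `ψ : ℝ → G` is closed and `ψ` is a smooth embedding, that is, a diffeomorphism of
`ℝ` onto the embedded submanifold `ψ(ℝ)` of `G`. -/
def IsClosedLine (ψ : ℝ → G) : Prop :=
  IsClosed (Set.range ψ) ∧ Manifold.IsSmoothEmbedding 𝓘(ℝ, ℝ) I ∞ ψ

/-- The image of `ψ : ℝ → G` is closed, it is the image of the circle group under a
smoothly embedding homomorphism `φ`, and `ψ`, read as a map `p` from `ℝ` to that circle,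
is a smooth covering map. -/
def IsClosedCircle (ψ : ℝ → G) : Prop :=
  IsClosed (Set.range ψ) ∧
    ∃ (φ : Circle →* G) (p : ℝ → Circle),
      Manifold.IsSmoothEmbedding (𝓡 1) I ∞ φ ∧ Set.range φ = Set.range ψ ∧
      IsCoveringMap p ∧ IsLocalDiffeomorph 𝓘(ℝ, ℝ) (𝓡 1) ∞ p ∧ ∀ s, ψ s = φ (p s)

/-- The image of `ψ : ℝ → G` is not closed, and its closure is a torus of dimension `k ≥ 2`:
the image of the Lie group `(S¹)ᵏ` under a smoothly embedding homomorphism. -/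
def HasTorusClosure (ψ : ℝ → G) : Prop :=
  ¬ IsClosed (Set.range ψ) ∧
    ∃ (k : ℕ) (φ : (Fin k → Circle) →* G), 2 ≤ k ∧
      Manifold.IsSmoothEmbedding (ModelWithCorners.pi fun _ : Fin k => 𝓡 1) I ∞ φ ∧
      Set.range φ = closure (Set.range ψ)

end

/-! Let `K` be the closure of `ψ(ℝ)`, a closed abelian subgroup, and let `𝔨` be the set of
velocities of one-parameter groups lying in `K`. Since `K` is abelian, the product of two such
groups is again one, with velocity the sum (`oneParam_add_left`). So `𝔨` is a vector space and the
exponential restricts to a smooth homomorphism `F : 𝔨 → K`, immersive at `0`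
(`isImmersiveHom_lieExp`).

The analytic core is the closed subgroup theorem in the form `nhdsWithin_le_map_lieExp`: `F` maps
neighbourhoods of `0` onto neighbourhoods of `1` in `K`. It rests on `oneParam_mem_of_tendsto`: a
limit of directions along which elements of `K` approach `1` belongs to `𝔨`. As `ψ(ℝ)` is dense in
`K`, it follows that `F(𝔨) = K`.

The kernel `Λ` of `F` is discrete. If `Λ` spans `𝔨`, it is a lattice and `K` is a torus of dimension
`dim 𝔨`. In dimension one this is the circle, and `ψ` covers it. In dimension at least two, `ψ(ℝ)`
is not all of `K`, by countability of `Λ`, hence is not closed. If `Λ` does not span, a nonzero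
linear form vanishing on `Λ` descends to `K`. By density it is nonzero on the velocity `u` of `ψ`,
so after rescaling it inverts `ψ` continuously, and `ψ` is an embedding with closed image
(`IsImmersiveHom.line_trichotomy`). -/

section

open Set Filter Topology

/-! ### Left-invariant flows and one-parameter groups -/

section OneParameterSubgroups

variable {E : Type*} [NormedAddCommGroup E] [NormedSpace ℝ E]
  {H : Type*} [TopologicalSpace H] {I : ModelWithCorners ℝ E H}
  {G : Type*} [TopologicalSpace G] [ChartedSpace H G] [Group G] [LieGroup I ∞ G]

theorem ContinuousLinearMap.comp_smulRight_one {V W : Type*} [NormedAddCommGroup V]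
    [NormedSpace ℝ V] [NormedAddCommGroup W] [NormedSpace ℝ W] (L : V →L[ℝ] W) (v : V) :
    L.comp ((1 : ℝ →L[ℝ] ℝ).smulRight v) = (1 : ℝ →L[ℝ] ℝ).smulRight (L v) := by
  ext
  simp

theorem hasMFDerivAt_mul_left (g x : G) :
    HasMFDerivAt I I (g * ·) x (mfderiv I I (g * ·) x) :=
  ((contMDiff_mul_left (I := I) (n := ∞) (a := g)).mdifferentiable (by simp) x).hasMFDerivAt

theorem mulInvariantVectorField_mul (w : GroupLieAlgebra I G) (g x : G) :
    mulInvariantVectorField (I := I) w (g * x) =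
      mfderiv I I (g * ·) x (mulInvariantVectorField (I := I) w x) := by
  have h : (fun y : G ↦ g * x * y) = (g * ·) ∘ (x * ·) := by
    ext y; simp [mul_assoc]
  have h1 : HasMFDerivAt I I (g * ·) (x * 1) (mfderiv I I (g * ·) x) := by
    rw [mul_one]; exact hasMFDerivAt_mul_left g x
  have h2 := h1.comp (1 : G) (hasMFDerivAt_mul_left (I := I) x 1)
  rw [← h] at h2
  simp only [mulInvariantVectorField]
  rw [h2.mfderiv]
  rfl

theorem contMDiff_mulInvariantVectorField_one (w : GroupLieAlgebra I G) :
    ContMDiff I I.tangent 1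
      (fun g : G ↦ (⟨g, mulInvariantVectorField w g⟩ : TangentBundle I G)) := by
  have : LieGroup I (minSmoothness ℝ 3) G := by
    rw [minSmoothness_of_isRCLikeNormedField]; infer_instance
  exact (contMDiff_mulInvariantVectorField (I := I) (G := G) w).of_le
    (one_le_two.trans le_minSmoothness)

theorem IsMIntegralCurveAt.mul_left {γ : ℝ → G} {w : GroupLieAlgebra I G} {t : ℝ}
    (hγ : IsMIntegralCurveAt γ (mulInvariantVectorField (I := I) w) t) (g : G) :
    IsMIntegralCurveAt (fun s ↦ g * γ s) (mulInvariantVectorField (I := I) w) t := by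
  filter_upwards [hγ] with s hs
  have h := (hasMFDerivAt_mul_left g (γ s)).comp s hs
  refine h.congr_mfderiv ?_
  rw [mulInvariantVectorField_mul]
  exact ContinuousLinearMap.comp_smulRight_one (V := E) (W := E) _ _

theorem IsMIntegralCurve.mul_left {γ : ℝ → G} {w : GroupLieAlgebra I G}
    (hγ : IsMIntegralCurve γ (mulInvariantVectorField (I := I) w)) (g : G) :
    IsMIntegralCurve (fun s ↦ g * γ s) (mulInvariantVectorField (I := I) w) := by
  rw [isMIntegralCurve_iff_isMIntegralCurveAt] at *
  exact fun t ↦ (hγ t).mul_left g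

/-- Near `t` the curve is the left translate by `γ t` of its germ at `0`, so its velocity there is
the left-invariant vector. With uniqueness of integral curves, a one-parameter group is thus
determined by its velocity at `0`. -/
theorem isMIntegralCurve_of_map_add {γ : ℝ → G} {w : GroupLieAlgebra I G}
    (hγ : ∀ s t, γ (s + t) = γ s * γ t)
    (hw : HasMFDerivAt 𝓘(ℝ, ℝ) I γ 0 ((1 : ℝ →L[ℝ] ℝ).smulRight (w : E))) :
    IsMIntegralCurve γ (mulInvariantVectorField (I := I) w) := by
  intro t
  have h0 : γ 0 = 1 := by simpa using hγ 0 0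
  have h1 : γ = (γ t * ·) ∘ γ ∘ (· - t) := by
    ext s; simp [← hγ]
  have h2 : HasMFDerivAt 𝓘(ℝ, ℝ) 𝓘(ℝ, ℝ) (fun s : ℝ ↦ s - t) t (ContinuousLinearMap.id ℝ ℝ) :=
    ((hasFDerivAt_id t).sub_const t).hasMFDerivAt
  have h3 : HasMFDerivAt 𝓘(ℝ, ℝ) I γ (t - t) ((1 : ℝ →L[ℝ] ℝ).smulRight (w : E)) := by
    rw [sub_self]; exact hw
  have h4 : HasMFDerivAt 𝓘(ℝ, ℝ) I (γ ∘ (· - t)) t _ :=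
    HasMFDerivAt.comp (f := fun s : ℝ ↦ s - t) t h3 h2
  have h5 : HasMFDerivAt I I (γ t * ·) ((γ ∘ (· - t)) t) (mfderiv I I (γ t * ·) (1 : G)) := by
    have h : (γ ∘ (· - t)) t = 1 := by simp [h0]
    rw [h]
    exact hasMFDerivAt_mul_left (I := I) _ _
  have h6 := h5.comp t h4
  rw [← h1] at h6
  refine h6.congr_mfderiv ?_
  exact ContinuousLinearMap.comp_smulRight_one (V := E) (W := E) _ _

variable [I.Boundaryless] [T2Space G]

theorem IsMIntegralCurve.eq_of_mulInvariantVectorField {γ γ' : ℝ → G} {w : GroupLieAlgebra I G}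
    (hγ : IsMIntegralCurve γ (mulInvariantVectorField (I := I) w))
    (hγ' : IsMIntegralCurve γ' (mulInvariantVectorField (I := I) w)) (h : γ 0 = γ' 0) :
    γ = γ' := by
  have : IsManifold I 1 G := IsManifold.of_le (n := ∞) (by simp)
  exact isMIntegralCurve_Ioo_eq_of_contMDiff_boundaryless (t₀ := 0)
    (contMDiff_mulInvariantVectorField_one w) hγ hγ' h

theorem lieExp_smul_eq {γ : ℝ → G} {w : GroupLieAlgebra I G} (h0 : γ 0 = 1)
    (hγ : IsMIntegralCurve γ (mulInvariantVectorField (I := I) w)) (s : ℝ) :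
    lieExp I (s • w) = γ s := by
  have h1 : IsMIntegralCurve (γ ∘ (· * s)) (mulInvariantVectorField (I := I) (s • w)) := by
    rw [mulInvariantVectorField_smul]
    exact hγ.comp_mul s
  have h : ∃ δ : ℝ → G, δ 0 = 1 ∧
      IsMIntegralCurve δ (mulInvariantVectorField (I := I) (G := G) (s • w)) :=
    ⟨γ ∘ (· * s), by simp [h0], h1⟩
  -- The reparametrised curve is a witness, so the default value is excluded; uniqueness then
  -- identifies the chosen curve with it.
  rw [lieExp, dif_pos h]
  have := h.choose_spec.2.eq_of_mulInvariantVectorField h1 (by simp [h0, h.choose_spec.1])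
  rw [this]
  simp

theorem oneParam_eq {γ : ℝ → G} {w : GroupLieAlgebra I G} (h0 : γ 0 = 1)
    (hγ : IsMIntegralCurve γ (mulInvariantVectorField (I := I) w)) :
    oneParam I w = γ :=
  funext fun s ↦ lieExp_smul_eq h0 hγ s

theorem oneParam_eq_of_map_add {γ : ℝ → G} {w : GroupLieAlgebra I G}
    (hγ : ∀ s t, γ (s + t) = γ s * γ t)
    (hw : HasMFDerivAt 𝓘(ℝ, ℝ) I γ 0 ((1 : ℝ →L[ℝ] ℝ).smulRight (w : E))) :
    oneParam I w = γ :=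
  oneParam_eq (by simpa using hγ 0 0) (isMIntegralCurve_of_map_add hγ hw)

variable [FiniteDimensional ℝ E]

/-- Left translating one local solution through `1` gives solutions through every point with the
same lifetime `ε`, and a uniform lifetime implies completeness. -/
theorem exists_isMIntegralCurve_mulInvariantVectorField (w : GroupLieAlgebra I G) :
    ∃ γ : ℝ → G, γ 0 = 1 ∧ IsMIntegralCurve γ (mulInvariantVectorField (I := I) w) := by
  have : IsManifold I 1 G := IsManifold.of_le (n := ∞) (by simp)
  have hv := contMDiff_mulInvariantVectorField_one (I := I) (G := G) w
  obtain ⟨γ, h0, hγ⟩ := exists_isMIntegralCurveAt_of_contMDiffAt_boundaryless 0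
    (hv.contMDiffAt (x := (1 : G)))
  obtain ⟨ε, hε, h⟩ := isMIntegralCurveAt_iff'.1 hγ
  refine exists_isMIntegralCurve_of_isMIntegralCurveOn hv hε (fun x ↦ ?_) 1
  refine ⟨fun s ↦ x * γ s, by simp [h0], ?_⟩
  rw [Real.ball_eq_Ioo, zero_sub, zero_add] at h
  rw [isMIntegralCurveOn_iff_isMIntegralCurveAt isOpen_Ioo] at *
  exact fun t ht ↦ (h t ht).mul_left x

theorem oneParam_zero (w : GroupLieAlgebra I G) : oneParam I w 0 = 1 := by
  obtain ⟨γ, h0, hγ⟩ := exists_isMIntegralCurve_mulInvariantVectorField w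
  rw [oneParam_eq h0 hγ, h0]

theorem isMIntegralCurve_oneParam (w : GroupLieAlgebra I G) :
    IsMIntegralCurve (oneParam I w) (mulInvariantVectorField (I := I) w) := by
  obtain ⟨γ, h0, hγ⟩ := exists_isMIntegralCurve_mulInvariantVectorField w
  rwa [oneParam_eq h0 hγ]

theorem oneParam_add (w : GroupLieAlgebra I G) (s t : ℝ) :
    oneParam I w (s + t) = oneParam I w s * oneParam I w t := by
  have h1 : IsMIntegralCurve (oneParam I w ∘ (· + s)) (mulInvariantVectorField (I := I) w) :=
    (isMIntegralCurve_oneParam w).comp_add s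
  have h := h1.eq_of_mulInvariantVectorField
    ((isMIntegralCurve_oneParam w).mul_left (oneParam I w s))
    (by simp [oneParam_zero])
  simpa [add_comm] using congrFun h t

theorem hasMFDerivAt_oneParam_zero (w : GroupLieAlgebra I G) :
    HasMFDerivAt 𝓘(ℝ, ℝ) I (oneParam I w) 0 ((1 : ℝ →L[ℝ] ℝ).smulRight (w : E)) := by
  refine (isMIntegralCurve_oneParam w 0).congr_mfderiv ?_
  rw [oneParam_zero]
  have h : HasMFDerivAt I I (fun x : G ↦ 1 * x) 1 (ContinuousLinearMap.id ℝ E) :=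
    (hasMFDerivAt_id (I := I) (1 : G)).congr_of_eventuallyEq (.of_forall fun x ↦ by simp)
  rw [mulInvariantVectorField, h.mfderiv]
  rfl

omit [LieGroup I ∞ G] [FiniteDimensional ℝ E] [I.Boundaryless] [T2Space G] in
theorem oneParam_smul (w : GroupLieAlgebra I G) (c s : ℝ) :
    oneParam I (c • w) s = oneParam I w (s * c) := by
  simp [oneParam, smul_smul]

theorem continuous_oneParam (w : GroupLieAlgebra I G) : Continuous (oneParam I w) :=
  (isMIntegralCurve_oneParam w).continuous

end OneParameterSubgroups

/-! ### Smoothness of one-parameter groups -/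

section Smoothness

/-- Bootstrap: if `z` is `C^n`, then so is its derivative `V ∘ z`, hence `z` is `C^(n+1)`. -/
theorem contDiffOn_infty_of_hasDerivAt {E : Type*} [NormedAddCommGroup E] [NormedSpace ℝ E]
    {z : ℝ → E} {V : E → E} {J : Set ℝ} {Ω : Set E} (hJ : IsOpen J)
    (hV : ContDiffOn ℝ ∞ V Ω) (hz : ∀ t ∈ J, HasDerivAt z (V (z t)) t) (hm : MapsTo z J Ω) :
    ContDiffOn ℝ ∞ z J := by
  rw [contDiffOn_infty]
  intro n
  induction n with
  | zero =>
    exact contDiffOn_zero.2 fun t ht ↦ (hz t ht).continuousAt.continuousWithinAt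
  | succ n ih =>
    push_cast
    rw [contDiffOn_succ_iff_deriv_of_isOpen hJ]
    refine ⟨fun t ht ↦ (hz t ht).differentiableAt.differentiableWithinAt, by simp, ?_⟩
    exact ((hV.of_le (by exact_mod_cast le_top)).comp ih hm).congr fun t ht ↦ (hz t ht).deriv

variable {E : Type*} [NormedAddCommGroup E] [NormedSpace ℝ E]
  {H : Type*} [TopologicalSpace H] {I : ModelWithCorners ℝ E H} [I.Boundaryless]
  {G : Type*} [TopologicalSpace G] [ChartedSpace H G] [Group G] [LieGroup I ∞ G]

omit [Group G] [LieGroup I ∞ G] [I.Boundaryless] in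
theorem hasMFDerivAt_iff_hasDerivAt_extChartAt {γ : ℝ → G} {t : ℝ} {g : G} (hg : γ t = g) {w : E} :
    HasMFDerivAt 𝓘(ℝ, ℝ) I γ t ((1 : ℝ →L[ℝ] ℝ).smulRight w) ↔
      ContinuousAt γ t ∧ HasDerivAt (fun s ↦ extChartAt I g (γ s)) w t := by
  subst hg
  have h : (1 : ℝ →L[ℝ] ℝ).smulRight w = ContinuousLinearMap.toSpanSingleton ℝ w := by
    ext; simp
  rw [hasDerivAt_iff_hasFDerivAt, ← hasFDerivWithinAt_univ, ← h]
  simp only [HasMFDerivAt, writtenInExtChartAt]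
  simp only [mfld_simps]
  rfl

theorem contMDiffAt_mul_extChartAt_symm {x y : E} (hx : x ∈ (extChartAt I (1 : G)).target)
    (hy : y ∈ (extChartAt I (1 : G)).target) :
    ContMDiffAt 𝓘(ℝ, E × E) I ∞
      (fun p : E × E ↦ (extChartAt I (1 : G)).symm p.1 * (extChartAt I (1 : G)).symm p.2)
      (x, y) := by
  have h := fun {x : E} (hx : x ∈ (extChartAt I (1 : G)).target) ↦
    (contMDiffOn_extChartAt_symm (I := I) (n := ∞) (1 : G)).contMDiffAt
      ((isOpen_extChartAt_target (I := I) (1 : G)).mem_nhds hx)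
  refine ContMDiffAt.mul ?_ ?_
  · exact ContMDiffAt.comp (x, y) (g := (extChartAt I (1 : G)).symm) (f := Prod.fst)
      (h hx) contDiff_fst.contMDiff.contMDiffAt
  · exact ContMDiffAt.comp (x, y) (g := (extChartAt I (1 : G)).symm) (f := Prod.snd)
      (h hy) contDiff_snd.contMDiff.contMDiffAt

theorem contDiffAt_extChartAt_mul {x y : E} (hx : x ∈ (extChartAt I (1 : G)).target)
    (hy : y ∈ (extChartAt I (1 : G)).target)
    (hxy : (extChartAt I (1 : G)).symm x * (extChartAt I (1 : G)).symm y ∈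
      (extChartAt I (1 : G)).source) :
    ContDiffAt ℝ ∞ (fun p : E × E ↦ extChartAt I (1 : G)
      ((extChartAt I (1 : G)).symm p.1 * (extChartAt I (1 : G)).symm p.2)) (x, y) := by
  rw [← contMDiffAt_iff_contDiffAt]
  refine ContMDiffAt.comp (x, y) (g := extChartAt I (1 : G)) ?_
    (contMDiffAt_mul_extChartAt_symm hx hy)
  exact contMDiffAt_extChartAt' (by simpa using hxy)

variable [FiniteDimensional ℝ E] [T2Space G]

/-- Differentiating `γ (t + s) = γ t * γ s` in `s` at `0`, in the chart at `1`, gives an autonomous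
equation whose right side is a partial derivative of the multiplication, hence smooth. This settles
smoothness near `0`; left translation carries it to every `t`. -/
theorem contMDiff_oneParam (w : GroupLieAlgebra I G) :
    ContMDiff 𝓘(ℝ, ℝ) I ∞ (oneParam I w) := by
  set γ := oneParam I w with hγ
  set χ := extChartAt I (1 : G) with hχ
  have hχo : IsOpen χ.source := isOpen_extChartAt_source _
  have hJ : IsOpen (γ ⁻¹' χ.source) := hχo.preimage (continuous_oneParam w)
  have h1 : (1 : G) ∈ χ.source := mem_extChartAt_source _
  have h1t : χ 1 ∈ χ.target := χ.map_source h1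
  have hz0 : HasDerivAt (fun s ↦ χ (γ s)) w 0 :=
    ((hasMFDerivAt_iff_hasDerivAt_extChartAt (oneParam_zero w)).1
      (hasMFDerivAt_oneParam_zero w)).2
  let μ : E × E → E := fun p ↦ χ (χ.symm p.1 * χ.symm p.2)
  have hμ : ∀ x ∈ χ.target, ContDiffAt ℝ ∞ μ (x, χ 1) := fun x hx ↦
    contDiffAt_extChartAt_mul hx h1t (by rw [← hχ, χ.left_inv h1, mul_one]; exact χ.map_target hx)
  have hV : ContDiffOn ℝ ∞ (fun x ↦ fderiv ℝ μ (x, χ 1) (0, w)) χ.target := by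
    intro x hx
    have h := (hμ x hx).fderiv_right (m := ∞) (by simp)
    exact ((h.comp x (contDiffAt_id.prodMk contDiffAt_const)).clm_apply
      contDiffAt_const).contDiffWithinAt
  have hz : ∀ t ∈ γ ⁻¹' χ.source, HasDerivAt (fun s ↦ χ (γ s))
      (fderiv ℝ μ (χ (γ t), χ 1) (0, w)) t := by
    intro t ht
    have h2 : HasFDerivAt μ (fderiv ℝ μ (χ (γ t), χ 1)) (χ (γ t), χ (γ 0)) := by
      rw [hγ, oneParam_zero]
      exact ((hμ _ (χ.map_source ht)).differentiableAt (by simp)).hasFDerivAt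
    have h3 := h2.comp_hasDerivAt (0 : ℝ) ((hasDerivAt_const (0 : ℝ) (χ (γ t))).prodMk hz0)
    have h4 : HasDerivAt (fun s ↦ χ (γ (t + s))) (fderiv ℝ μ (χ (γ t), χ 1) (0, w)) 0 := by
      refine h3.congr_of_eventuallyEq ?_
      have : ∀ᶠ s in 𝓝 (0 : ℝ), γ s ∈ χ.source :=
        (continuous_oneParam w).continuousAt.eventually_mem
          (hχo.mem_nhds (by rw [oneParam_zero]; exact h1))
      filter_upwards [this] with s hs
      simp only [Function.comp_apply, μ]
      rw [χ.left_inv ht, χ.left_inv hs, hγ, oneParam_add]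
    have h5 : HasDerivAt (fun s ↦ χ (γ (t + s))) (fderiv ℝ μ (χ (γ t), χ 1) (0, w)) (t - t) := by
      rwa [sub_self]
    have h6 := HasDerivAt.scomp (h := fun s ↦ s - t) t h5 ((hasDerivAt_id t).sub_const t)
    simpa [Function.comp_def] using h6
  have hzs := contDiffOn_infty_of_hasDerivAt hJ hV hz fun t ht ↦ χ.map_source ht
  have h0 : ContMDiffAt 𝓘(ℝ, ℝ) I ∞ γ 0 := by
    have h0J : (0 : ℝ) ∈ γ ⁻¹' χ.source := by rw [mem_preimage, hγ, oneParam_zero]; exact h1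
    have h2 : ContMDiffOn 𝓘(ℝ, ℝ) I ∞ (χ.symm ∘ fun s ↦ χ (γ s)) (γ ⁻¹' χ.source) :=
      (contMDiffOn_extChartAt_symm (1 : G)).comp hzs.contMDiffOn fun t ht ↦ χ.map_source ht
    exact (h2.congr fun t ht ↦ (χ.left_inv ht).symm).contMDiffAt (hJ.mem_nhds h0J)
  intro t
  have h2 : γ = (γ t * ·) ∘ γ ∘ (· - t) := by
    ext s; simp [hγ, ← oneParam_add]
  rw [h2]
  refine ContMDiffAt.comp t (contMDiff_mul_left (I := I)).contMDiffAt
    (ContMDiffAt.comp t (I' := 𝓘(ℝ, ℝ)) ?_ ?_)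
  · simpa using h0
  · exact (contDiff_id.sub contDiff_const).contMDiff.contMDiffAt

end Smoothness

/-! ### The local immersion theorem -/

section Immersions

theorem exists_openPartialHomeomorph_of_hasFDerivAt {V W : Type*} [NormedAddCommGroup V]
    [NormedSpace ℝ V] [CompleteSpace V] [NormedAddCommGroup W] [NormedSpace ℝ W]
    {Θ : V → W} {U : Set V} {a : V} (hU : IsOpen U) (hΘ : ContDiffOn ℝ ∞ Θ U) (ha : a ∈ U)
    (T : V ≃L[ℝ] W) (hT : HasFDerivAt Θ (T : V →L[ℝ] W) a) :
    ∃ e : OpenPartialHomeomorph V W, a ∈ e.source ∧ e.source ⊆ U ∧ (∀ x, e x = Θ x) ∧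
      ContDiffOn ℝ ∞ e.symm e.target := by
  have hΘa : ContDiffAt ℝ ∞ Θ a := hΘ.contDiffAt (hU.mem_nhds ha)
  -- The inverse is known to be smooth only where the derivative is invertible. This is an open
  -- condition, so the source is cut down to it.
  let S : Set V := U ∩ fderiv ℝ Θ ⁻¹' range ((↑) : (V ≃L[ℝ] W) → V →L[ℝ] W)
  have hS : IsOpen S :=
    ((hΘ.continuousOn_fderiv_of_isOpen hU (by simp)).isOpen_inter_preimage hU
      ContinuousLinearEquiv.isOpen)
  have haS : a ∈ S := ⟨ha, T, hT.fderiv.symm⟩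
  let e := (hΘa.toOpenPartialHomeomorph Θ hT (by simp)).restrOpen S hS
  refine ⟨e, ⟨hΘa.mem_toOpenPartialHomeomorph_source hT (by simp), haS⟩, fun x hx ↦ hx.2.1,
    fun x ↦ rfl, fun y hy ↦ ?_⟩
  have hx := e.map_target hy
  obtain ⟨T', hT'⟩ := hx.2.2
  have hx' : ContDiffAt ℝ ∞ Θ (e.symm y) := hΘ.contDiffAt (hU.mem_nhds hx.2.1)
  refine (e.contDiffAt_symm (f₀' := T') hy ?_ hx').contDiffWithinAt
  have := (hx'.differentiableAt (by simp)).hasFDerivAt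
  rw [← hT'] at this
  exact this

theorem exists_continuousLinearEquiv_of_injective {V W F : Type*}
    [NormedAddCommGroup V] [NormedSpace ℝ V] [FiniteDimensional ℝ V]
    [NormedAddCommGroup W] [NormedSpace ℝ W] [FiniteDimensional ℝ W]
    [NormedAddCommGroup F] [NormedSpace ℝ F] [FiniteDimensional ℝ F]
    (hF : Module.finrank ℝ V + Module.finrank ℝ F = Module.finrank ℝ W)
    (A : V →L[ℝ] W) (hA : Function.Injective A) :
    ∃ (B : F →L[ℝ] W) (T : (V × F) ≃L[ℝ] W), ∀ p, T p = A p.1 + B p.2 := by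
  obtain ⟨C, hC⟩ := Submodule.exists_isCompl (LinearMap.range (A : V →ₗ[ℝ] W))
  have h1 := Submodule.finrank_add_eq_of_isCompl hC
  rw [LinearMap.finrank_range_of_inj hA] at h1
  let b : F ≃ₗ[ℝ] C := LinearEquiv.ofFinrankEq _ _ (by omega)
  let a := LinearEquiv.ofInjective (A : V →ₗ[ℝ] W) hA
  refine ⟨LinearMap.toContinuousLinearMap (C.subtype ∘ₗ b.toLinearMap),
    ((a.prodCongr b).trans (Submodule.prodEquivOfIsCompl _ _ hC)).toContinuousLinearEquiv,
    fun p ↦ ?_⟩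
  simp [a]

variable {E₁ E₂ F : Type*} [NormedAddCommGroup E₁] [NormedSpace ℝ E₁] [FiniteDimensional ℝ E₁]
  [NormedAddCommGroup E₂] [NormedSpace ℝ E₂] [FiniteDimensional ℝ E₂]
  [NormedAddCommGroup F] [NormedSpace ℝ F] [FiniteDimensional ℝ F]
  {H₁ : Type*} [TopologicalSpace H₁] {I : ModelWithCorners ℝ E₁ H₁}
  {H₂ : Type*} [TopologicalSpace H₂] {J : ModelWithCorners ℝ E₂ H₂} [J.Boundaryless]
  {M : Type*} [TopologicalSpace M] [ChartedSpace H₁ M]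
  {N : Type*} [TopologicalSpace N] [ChartedSpace H₂ N] [IsManifold J ∞ N]

-- The straightening chart of the immersion theorem: the local diffeomorphism `e` is undone, and `T`
-- brings the result back to the model space of `N`.
omit [FiniteDimensional ℝ E₂] [FiniteDimensional ℝ E₁] [FiniteDimensional ℝ F] in
theorem exists_mem_maximalAtlas_extend_eq (y : N) (e : OpenPartialHomeomorph E₁ E₂)
    (hes : e.target ⊆ (extChartAt J y).target)
    (he : ContDiffOn ℝ ∞ e e.source) (he' : ContDiffOn ℝ ∞ e.symm e.target) (T : E₁ ≃L[ℝ] E₂) :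
    ∃ c ∈ IsManifold.maximalAtlas J ∞ N,
      c.source = (extChartAt J y).source ∩ extChartAt J y ⁻¹' e.target ∧
      ∀ z, c.extend J z = T (e.symm (extChartAt J y z)) := by
  let c : OpenPartialHomeomorph N H₂ := (chartAt H₂ y).trans
    (J.toHomeomorph.toOpenPartialHomeomorph.trans (e.symm.trans
      (T.toHomeomorph.trans J.toHomeomorph.symm).toOpenPartialHomeomorph))
  have hc : c.source = (extChartAt J y).source ∩ extChartAt J y ⁻¹' e.target := by
    ext z; simp [c]
  have hct : ∀ z ∈ c.target, T.symm (J z) ∈ e.source ∧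
      e (T.symm (J z)) ∈ (extChartAt J y).target := by
    intro z hz
    have h1 : T.symm (J z) ∈ e.source := by
      have h : T.symm (J z) ∈ e.source ∧ J.symm (e (T.symm (J z))) ∈ (chartAt H₂ y).target := by
        simpa [c] using hz
      exact h.1
    exact ⟨h1, hes (e.map_source h1)⟩
  refine ⟨c, ?_, hc, fun z ↦ ?_⟩
  · refine c.mem_maximalAtlas_of_contMDiffOn ?_ ?_
    · rw [hc]
      have h1 : ContMDiffOn J 𝓘(ℝ, E₂) ∞ (extChartAt J y)
          ((extChartAt J y).source ∩ extChartAt J y ⁻¹' e.target) :=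
        (contMDiffOn_extChartAt (I := J) (n := ∞) (x := y)).mono fun z hz ↦ by simpa using hz.1
      have h2 : ContMDiffOn J 𝓘(ℝ, E₂) ∞ (fun z ↦ T (e.symm (extChartAt J y z)))
          ((extChartAt J y).source ∩ extChartAt J y ⁻¹' e.target) :=
        T.contDiff.contMDiff.comp_contMDiffOn (he'.contMDiffOn.comp h1 fun z hz ↦ hz.2)
      exact (J.contMDiffOn_symm (n := ∞)).comp h2 fun z hz ↦ by simp [J.range_eq_univ]
    · have h1 : ContMDiffOn J 𝓘(ℝ, E₁) ∞ (fun z ↦ T.symm (J z)) c.target :=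
        (T.symm.contDiff.contMDiff.comp J.contMDiff).contMDiffOn
      exact (contMDiffOn_extChartAt_symm (I := J) (n := ∞) y).comp
        (he.contMDiffOn.comp h1 fun z hz ↦ (hct z hz).1) fun z hz ↦ (hct z hz).2
  · have h (u : E₂) : J (J.symm u) = u := J.right_inv (by simp [J.range_eq_univ])
    simp [c, h]

/-- The map `(u, v) ↦ ψ (g u) + B v`, with `B` onto a complement of the image of the derivative, has
invertible derivative at `(a, 0)`. Its local inverse is a chart of `N` in which `f` becomes `u ↦ T
(u, 0)`. The factor `g` will be a homomorphism from a vector space, and `φ` a local lift to that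
space. -/
theorem isImmersionAtOfComplement_of_injective_fderiv
    (hF : Module.finrank ℝ E₁ + Module.finrank ℝ F = Module.finrank ℝ E₂)
    {f : M → N} {x : M} {φ : OpenPartialHomeomorph M H₁} (hφ : φ ∈ IsManifold.maximalAtlas I ∞ M)
    (hx : x ∈ φ.source) {g : E₁ → N} (hg : ContMDiff 𝓘(ℝ, E₁) J ∞ g)
    (hfg : ∀ z ∈ φ.source, f z = g (φ.extend I z))
    (hinj : Function.Injective (fderiv ℝ (fun u ↦ extChartAt J (f x) (g u)) (φ.extend I x))) :
    Manifold.IsImmersionAtOfComplement F I J ∞ f x := by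
  set ψ := extChartAt J (f x) with hψ
  set a := φ.extend I x with ha
  have hga : g a = f x := (hfg x hx).symm
  obtain ⟨B, T, hT⟩ := exists_continuousLinearEquiv_of_injective hF _ hinj
  let U : Set (E₁ × F) :=
    {p | g p.1 ∈ ψ.source} ∩ {p | ψ (g p.1) + B p.2 ∈ ψ.target}
  have hgo : IsOpen (g ⁻¹' ψ.source) :=
    (isOpen_extChartAt_source (I := J) (f x)).preimage hg.continuous
  have hψg : ContDiffOn ℝ ∞ (fun u ↦ ψ (g u)) (g ⁻¹' ψ.source) := by
    rw [← contMDiffOn_iff_contDiffOn]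
    exact (contMDiffOn_extChartAt (I := J) (n := ∞) (x := f x)).comp hg.contMDiffOn
      fun u hu ↦ by simpa [hψ] using hu
  have hΘ' : ContDiffOn ℝ ∞ (fun p : E₁ × F ↦ ψ (g p.1) + B p.2) {p | g p.1 ∈ ψ.source} :=
    (hψg.comp contDiff_fst.contDiffOn fun p hp ↦ hp).add (B.contDiff.comp contDiff_snd).contDiffOn
  have hU : IsOpen U := hΘ'.continuousOn.isOpen_inter_preimage (hgo.preimage continuous_fst)
    (isOpen_extChartAt_target (I := J) (f x))
  have hΘ := hΘ'.mono (inter_subset_left : U ⊆ _)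
  have hfa : g a ∈ ψ.source := by rw [hga]; exact mem_extChartAt_source _
  have haU : ((a, 0) : E₁ × F) ∈ U := by
    refine ⟨hfa, ?_⟩
    simpa using ψ.map_source hfa
  have hTd : HasFDerivAt (fun p : E₁ × F ↦ ψ (g p.1) + B p.2) (T : E₁ × F →L[ℝ] E₂) (a, 0) := by
    have h1 : HasFDerivAt (fun u ↦ ψ (g u)) (fderiv ℝ (fun u ↦ ψ (g u)) a) (a, (0 : F)).1 :=
      ((hψg.contDiffAt (hgo.mem_nhds hfa)).differentiableAt (by simp)).hasFDerivAt
    have h2 := (h1.comp (a, (0 : F)) hasFDerivAt_fst).add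
      (B.hasFDerivAt.comp (a, (0 : F)) hasFDerivAt_snd)
    have h3 : (T : E₁ × F →L[ℝ] E₂) = (fderiv ℝ (fun u ↦ ψ (g u)) a).comp
        (ContinuousLinearMap.fst ℝ E₁ F) + B.comp (ContinuousLinearMap.snd ℝ E₁ F) :=
      ContinuousLinearMap.ext fun p ↦ hT p
    rw [h3]
    exact h2
  obtain ⟨e, hae, heU, he, he'⟩ := exists_openPartialHomeomorph_of_hasFDerivAt hU hΘ haU T hTd
  have het : e.target ⊆ ψ.target := fun y hy ↦ by
    have h := (heU (e.map_target hy)).2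
    have h2 := e.right_inv hy
    rw [he] at h2
    rw [mem_ofPred_eq, h2] at h
    exact h
  have hee : ContDiffOn ℝ ∞ e e.source := (hΘ.mono heU).congr fun p _ ↦ he p
  obtain ⟨c, hc, hcs, hce⟩ := exists_mem_maximalAtlas_extend_eq (J := J) (f x) e het hee he' T
  -- The source chart is shrunk to the points whose slice `(u, 0)` stays in the domain of the
  -- straightening map.
  have hUo : IsOpen (φ.source ∩ φ.extend I ⁻¹' {u | (u, (0 : F)) ∈ e.source}) :=
    φ.extend_source (I := I) ▸ (φ.continuousOn_extend (I := I)).isOpen_inter_preimage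
      (φ.isOpen_extend_source (I := I))
      (e.open_source.preimage (continuous_id.prodMk continuous_const))
  have key : ∀ u, (u, (0 : F)) ∈ e.source → g u ∈ c.source ∧ c.extend J (g u) = T (u, 0) := by
    intro u hu
    have h1 : ψ (g u) = e (u, 0) := by rw [he]; simp
    refine ⟨?_, ?_⟩
    · rw [hcs]
      refine ⟨(heU hu).1, ?_⟩
      change ψ (g u) ∈ e.target
      rw [h1]; exact e.map_source hu
    · rw [hce, ← hψ, h1, e.left_inv hu]
  refine Manifold.IsImmersionAtOfComplement.mk_of_charts T (φ.restr _) c ?_ ?_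
    (restr_mem_maximalAtlas _ hφ hUo) hc ?_ ?_
  · simp only [OpenPartialHomeomorph.restr_source, hUo.interior_eq]
    exact ⟨hx, hx, hae⟩
  · rw [← hga]; exact (key a hae).1
  · intro z hz
    simp only [OpenPartialHomeomorph.restr_source, hUo.interior_eq] at hz
    rw [mem_preimage, hfg z hz.1]
    exact (key _ hz.2.2).1
  · intro u hu
    have hz := ((φ.restr _).extend I).map_target hu
    have h2 := ((φ.restr _).extend I).right_inv hu
    simp only [OpenPartialHomeomorph.extend_source, OpenPartialHomeomorph.restr_source,
      hUo.interior_eq] at hz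
    set z := ((φ.restr _).extend I).symm u
    have h3 : φ.extend I z = u := h2
    simp only [Function.comp_apply]
    rw [hfg z hz.1, h3]
    refine (key u ?_).2
    have := hz.2.2
    rwa [mem_preimage, h3] at this

end Immersions

/-! ### Products of charts -/

section PiCharts

variable {ι : Type*} [Fintype ι] {n : ℕ∞ω} {E H M : ι → Type*}
  [∀ i, NormedAddCommGroup (E i)] [∀ i, NormedSpace ℝ (E i)] [∀ i, TopologicalSpace (H i)]
  (I : ∀ i, ModelWithCorners ℝ (E i) (H i)) [∀ i, TopologicalSpace (M i)]
  [∀ i, ChartedSpace (H i) (M i)]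

theorem contDiffOn_pi_of_mem_contDiffGroupoid {e : ∀ i, OpenPartialHomeomorph (H i) (H i)}
    (he : ∀ i, e i ∈ contDiffGroupoid n (I i)) :
    ContDiffOn ℝ n (ModelWithCorners.pi I ∘ OpenPartialHomeomorph.pi e ∘
      (ModelWithCorners.pi I).symm)
      ((ModelWithCorners.pi I).symm ⁻¹' (OpenPartialHomeomorph.pi e).source ∩
        range (ModelWithCorners.pi I)) := by
  rw [contDiffOn_pi]
  intro i
  have h := (mem_groupoid_of_pregroupoid.1 (he i)).1
  refine ContDiffOn.comp (g := I i ∘ e i ∘ (I i).symm) (f := fun x : ∀ i, E i ↦ x i) h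
    (ContinuousLinearMap.proj (R := ℝ) (φ := E) i).contDiff.contDiffOn ?_
  rintro x ⟨hx, y, rfl⟩
  exact ⟨hx i (mem_univ i), y i, rfl⟩

theorem pi_mem_contDiffGroupoid {e : ∀ i, OpenPartialHomeomorph (H i) (H i)}
    (he : ∀ i, e i ∈ contDiffGroupoid n (I i)) :
    (OpenPartialHomeomorph.pi e : OpenPartialHomeomorph (ModelPi H) (ModelPi H)) ∈
      contDiffGroupoid n (ModelWithCorners.pi I) :=
  mem_groupoid_of_pregroupoid.2 ⟨contDiffOn_pi_of_mem_contDiffGroupoid I he,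
    contDiffOn_pi_of_mem_contDiffGroupoid I fun i ↦ (contDiffGroupoid n (I i)).symm (he i)⟩

theorem pi_mem_maximalAtlas {c : ∀ i, OpenPartialHomeomorph (M i) (H i)}
    (hc : ∀ i, c i ∈ IsManifold.maximalAtlas (I i) n (M i)) :
    (OpenPartialHomeomorph.pi c : OpenPartialHomeomorph (∀ i, M i) (ModelPi H)) ∈
      IsManifold.maximalAtlas (ModelWithCorners.pi I) n (∀ i, M i) := by
  have key : ∀ a b : ∀ i, OpenPartialHomeomorph (M i) (H i),
      ((OpenPartialHomeomorph.pi a).symm.trans (OpenPartialHomeomorph.pi b) :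
        OpenPartialHomeomorph (ModelPi H) (ModelPi H)) =
      OpenPartialHomeomorph.pi fun i ↦ (a i).symm.trans (b i) := by
    intro a b
    refine OpenPartialHomeomorph.ext _ _ (fun x ↦ rfl) (fun x ↦ rfl) ?_
    ext x
    exact ⟨fun h i hi ↦ ⟨h.1 i hi, h.2 i hi⟩,
      fun h ↦ ⟨fun i hi ↦ (h i hi).1, fun i hi ↦ (h i hi).2⟩⟩
  rintro _ ⟨e, he, rfl⟩
  rw [key, key]
  exact ⟨pi_mem_contDiffGroupoid I fun i ↦ (hc i _ (he i (mem_univ i))).1,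
    pi_mem_contDiffGroupoid I fun i ↦ (hc i _ (he i (mem_univ i))).2⟩

end PiCharts

/-! ### Argument charts on the circle -/

section CircleCharts

/-- The argument is the imaginary part of the logarithm, smooth on the slit plane; dividing by
`Circle.exp x` centres the branch at `x`. -/
theorem contMDiffOn_circle_arg (x : ℝ) : ContMDiffOn (𝓡 1) 𝓘(ℝ, ℝ) ∞
    (fun c : Circle ↦ x + Complex.arg (c / Circle.exp x : Circle))
    {c | ((c / Circle.exp x : Circle) : ℂ) ∈ Complex.slitPlane} := by
  have : Fact (Module.finrank ℝ ℂ = 1 + 1) := finrank_real_complex_fact'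
  have h1 : ContMDiff (𝓡 1) 𝓘(ℝ, ℂ) ∞ (fun c : Circle ↦ ((c / Circle.exp x : Circle) : ℂ)) :=
    (contMDiff_coe_sphere (E := ℂ)).comp
      (contMDiff_id.div (I := 𝓡 1) (I' := 𝓡 1) contMDiff_const)
  have h2 : ContDiffOn ℝ ∞ (fun z : ℂ ↦ x + Complex.arg z) Complex.slitPlane := fun z hz ↦
    ((contDiffAt_const (c := x)).add (Complex.imCLM.contDiff.contDiffAt.comp z
      ((Complex.contDiffAt_log hz).restrict_scalars ℝ))).contDiffWithinAt.congr
      (fun w _ ↦ by simp [Complex.log_im]) (by simp [Complex.log_im])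
  exact h2.contMDiffOn.comp h1.contMDiffOn fun c hc ↦ hc

/-- The circle exponential, as a partial diffeomorphism on an interval of length `2π`. -/
noncomputable def Circle.expPartialDiffeomorph (x : ℝ) :
    PartialDiffeomorph 𝓘(ℝ, ℝ) (𝓡 1) ℝ Circle ∞ where
  toFun := Circle.exp
  invFun c := x + Complex.arg (c / Circle.exp x : Circle)
  source := Ioo (x - Real.pi) (x + Real.pi)
  target := {c | ((c / Circle.exp x : Circle) : ℂ) ∈ Complex.slitPlane}
  map_source' s hs := by
    rw [mem_ofPred_eq, ← Circle.exp_sub, Complex.mem_slitPlane_iff_arg, Circle.arg_exp]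
    · exact ⟨by linarith [hs.2], Circle.coe_ne_zero _⟩
    · linarith [hs.1]
    · linarith [hs.2]
  map_target' c hc := by
    have h := Complex.mem_slitPlane_iff_arg.1 hc
    have h1 := Complex.neg_pi_lt_arg (c / Circle.exp x : Circle)
    have h2 := (Complex.arg_le_pi (c / Circle.exp x : Circle)).lt_of_ne h.1
    exact ⟨by linarith, by linarith⟩
  left_inv' s hs := by
    rw [← Circle.exp_sub, Circle.arg_exp]
    · ring
    · linarith [hs.1]
    · linarith [hs.2]
  right_inv' c hc := by
    rw [Circle.exp_add, Circle.exp_arg, mul_div_cancel]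
  open_source := isOpen_Ioo
  open_target := Complex.isOpen_slitPlane.preimage
    (show Continuous fun c : Circle ↦ ((c / Circle.exp x : Circle) : ℂ) by fun_prop)
  contMDiffOn_toFun := contMDiff_circleExp.contMDiffOn
  contMDiffOn_invFun := contMDiffOn_circle_arg x

/-- The linear identification of the line with one-dimensional Euclidean space. -/
noncomputable def lineEquivEuclidean : ℝ ≃L[ℝ] EuclideanSpace ℝ (Fin 1) :=
  (ContinuousLinearEquiv.funUnique (Fin 1) ℝ ℝ).symm.trans (EuclideanSpace.equiv (Fin 1) ℝ).symm

theorem lineEquivEuclidean_symm_apply (v : EuclideanSpace ℝ (Fin 1)) :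
    lineEquivEuclidean.symm v = v 0 := rfl

/-- The chart of the circle given by a branch of the argument. -/
noncomputable def Circle.argChart (x : ℝ) :
    OpenPartialHomeomorph Circle (EuclideanSpace ℝ (Fin 1)) :=
  (Circle.expPartialDiffeomorph x).symm.toOpenPartialHomeomorph.trans
    lineEquivEuclidean.toHomeomorph.toOpenPartialHomeomorph

/-- The chart coordinate is a local lift through `Circle.exp`, which is what lets maps from the
circle or a torus be read as homomorphisms from a vector space. -/
theorem Circle.exp_argChart {x : ℝ} {c : Circle} (hc : c ∈ (Circle.argChart x).source) :
    Circle.exp (Circle.argChart x c 0) = c :=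
  (Circle.expPartialDiffeomorph x).right_inv' hc.1

theorem Circle.mem_argChart_source (x : ℝ) : Circle.exp x ∈ (Circle.argChart x).source :=
  ⟨(Circle.expPartialDiffeomorph x).map_source'
    (show x ∈ Ioo _ _ from ⟨by linarith [Real.pi_pos], by linarith [Real.pi_pos]⟩), trivial⟩

theorem Circle.argChart_mem_maximalAtlas (x : ℝ) :
    Circle.argChart x ∈ IsManifold.maximalAtlas (𝓡 1) ∞ Circle := by
  have : IsManifold (𝓡 1) ∞ Circle := IsManifold.of_le (n := ω) le_top
  refine (Circle.argChart x).mem_maximalAtlas_of_contMDiffOn ?_ ?_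
  · exact lineEquivEuclidean.contDiff.contMDiff.comp_contMDiffOn
      ((contMDiffOn_circle_arg x).mono fun c hc ↦ hc.1)
  · exact (contMDiff_circleExp.comp lineEquivEuclidean.symm.contDiff.contMDiff).contMDiffOn

theorem Circle.isLocalDiffeomorph_exp : IsLocalDiffeomorph 𝓘(ℝ, ℝ) (𝓡 1) ∞ Circle.exp :=
  fun x ↦ ⟨Circle.expPartialDiffeomorph x,
    (show x ∈ Ioo _ _ from ⟨by linarith [Real.pi_pos], by linarith [Real.pi_pos]⟩), fun _ _ ↦ rfl⟩

end CircleCharts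

/-! ### Immersive homomorphisms from vector spaces -/

section ImmersedSubgroups

variable {V : Type*} [NormedAddCommGroup V] [NormedSpace ℝ V]
  {E : Type*} [NormedAddCommGroup E] [NormedSpace ℝ E]
  {H : Type*} [TopologicalSpace H] (I : ModelWithCorners ℝ E H)
  {G : Type*} [TopologicalSpace G] [ChartedSpace H G] [Group G]

/-- A smooth homomorphism from a vector space to a Lie group, immersive at the origin. -/
structure IsImmersiveHom (F : V → G) : Prop where
  contMDiff : ContMDiff 𝓘(ℝ, V) I ∞ F
  map_add : ∀ x y, F (x + y) = F x * F y
  injective_mfderiv : Function.Injective (mfderiv 𝓘(ℝ, V) I F 0)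

variable {I}

omit [Group G] in
theorem HasMFDerivAt.hasFDerivAt_extChartAt {F : V → G} {a : V} {L : V →L[ℝ] E}
    (hF : HasMFDerivAt 𝓘(ℝ, V) I F a L) :
    HasFDerivAt (fun u ↦ extChartAt I (F a) (F u)) L a := by
  have h := hF.2
  rw [← hasFDerivWithinAt_univ]
  simp only [writtenInExtChartAt, mfld_simps] at h
  exact h

namespace IsImmersiveHom

variable {F : V → G}

theorem map_zero (hF : IsImmersiveHom I F) : F 0 = 1 := by
  simpa using hF.map_add 0 0

theorem map_neg (hF : IsImmersiveHom I F) (x : V) : F (-x) = (F x)⁻¹ := by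
  rw [eq_inv_iff_mul_eq_one, ← hF.map_add, neg_add_cancel, hF.map_zero]

theorem map_sub (hF : IsImmersiveHom I F) (x y : V) : F (x - y) = F x * (F y)⁻¹ := by
  rw [sub_eq_add_neg, hF.map_add, hF.map_neg]

theorem eq_iff (hF : IsImmersiveHom I F) {x y : V} : F x = F y ↔ F (x - y) = 1 := by
  rw [hF.map_sub, mul_inv_eq_one]

theorem continuous (hF : IsImmersiveHom I F) : Continuous F := hF.contMDiff.continuous

/-- `F` equals the translate by `(F a)⁻¹` of `u ↦ F (a + u)`, so a vector killed by the derivative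
at `a` is killed by the one at `0`. -/
theorem injective_mfderiv_at [LieGroup I ∞ G] (hF : IsImmersiveHom I F) (a : V) :
    Function.Injective (mfderiv 𝓘(ℝ, V) I F a) := by
  have hd : ∀ x, HasMFDerivAt 𝓘(ℝ, V) I F x (mfderiv 𝓘(ℝ, V) I F x) := fun x ↦
    (hF.contMDiff.mdifferentiable (by simp) x).hasMFDerivAt
  have h1 : HasMFDerivAt 𝓘(ℝ, V) 𝓘(ℝ, V) (fun u ↦ a + u) 0 (ContinuousLinearMap.id ℝ V) :=
    ((hasFDerivAt_id (𝕜 := ℝ) (0 : V)).const_add a).hasMFDerivAt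
  have h2 : HasMFDerivAt 𝓘(ℝ, V) I F (a + 0) (mfderiv 𝓘(ℝ, V) I F a) := by
    rw [add_zero]; exact hd a
  have h3 := HasMFDerivAt.comp (f := fun u ↦ a + u) (0 : V) h2 h1
  have h4 := (hasMFDerivAt_mul_left (I := I) (F a)⁻¹ ((F ∘ fun u ↦ a + u) 0)).comp (0 : V) h3
  have h5 : ((F a)⁻¹ * ·) ∘ F ∘ (fun u ↦ a + u) = F := by
    ext u; simp [hF.map_add]
  rw [h5] at h4
  have h6 := hF.injective_mfderiv
  rw [h4.mfderiv] at h6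
  exact fun v w hvw ↦ h6 (congrArg (mfderiv I I ((F a)⁻¹ * ·) ((F ∘ fun u ↦ a + u) 0)) hvw)

theorem injective_fderiv_extChartAt [LieGroup I ∞ G] (hF : IsImmersiveHom I F) (a : V) :
    Function.Injective (fderiv ℝ (fun u ↦ extChartAt I (F a) (F u)) a) := by
  rw [(hF.contMDiff.mdifferentiable (by simp) a).hasMFDerivAt.hasFDerivAt_extChartAt.fderiv]
  exact hF.injective_mfderiv_at a

/-- Stated for any `f` that locally factors through `F` by a chart, so that it covers the line, the
circle and the torus at once. -/
theorem isImmersion [LieGroup I ∞ G] [FiniteDimensional ℝ E] [FiniteDimensional ℝ V]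
    [I.Boundaryless] (hF : IsImmersiveHom I F)
    {E₁ : Type*} [NormedAddCommGroup E₁] [NormedSpace ℝ E₁] [FiniteDimensional ℝ E₁]
    {H₁ : Type*} [TopologicalSpace H₁] {J : ModelWithCorners ℝ E₁ H₁}
    {M : Type*} [TopologicalSpace M] [ChartedSpace H₁ M] {f : M → G} (e : E₁ ≃L[ℝ] V)
    (hf : ∀ x, ∃ φ ∈ IsManifold.maximalAtlas J ∞ M, x ∈ φ.source ∧
      ∀ z ∈ φ.source, f z = F (e (φ.extend J z))) :
    Manifold.IsImmersion J I ∞ f := by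
  have hE : Module.finrank ℝ E₁ ≤ Module.finrank ℝ E := by
    rw [e.toLinearEquiv.finrank_eq]
    exact LinearMap.finrank_le_finrank_of_injective
      (f := (fderiv ℝ (fun u ↦ extChartAt I (F 0) (F u)) 0 : V →ₗ[ℝ] E))
      (hF.injective_fderiv_extChartAt 0)
  refine Manifold.IsImmersionOfComplement.isImmersion
    (F := Fin (Module.finrank ℝ E - Module.finrank ℝ E₁) → ℝ) fun x ↦ ?_
  obtain ⟨φ, hφ, hx, hfφ⟩ := hf x
  refine isImmersionAtOfComplement_of_injective_fderiv (by simp [hE]) hφ hx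
    (g := F ∘ e) (hF.contMDiff.comp e.contDiff.contMDiff) hfφ ?_
  rw [hfφ x hx]
  set a := φ.extend J x
  have h1 := hF.injective_fderiv_extChartAt (e a)
  have h2 : fderiv ℝ (fun u ↦ extChartAt I (F (e a)) ((F ∘ e) u)) a =
      (fderiv ℝ (fun u ↦ extChartAt I (F (e a)) (F u)) (e a)).comp (e : E₁ →L[ℝ] V) :=
    e.comp_right_fderiv (f := fun u ↦ extChartAt I (F (e a)) (F u))
  rw [h2]
  exact h1.comp e.injective

end IsImmersiveHom

variable [LieGroup I ∞ G] [FiniteDimensional ℝ E] [I.Boundaryless]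

theorem IsImmersiveHom.isImmersion_self [FiniteDimensional ℝ V] {F : V → G}
    (hF : IsImmersiveHom I F) : Manifold.IsImmersion 𝓘(ℝ, V) I ∞ F :=
  hF.isImmersion (.refl ℝ V) fun x ↦ ⟨chartAt V x, IsManifold.chart_mem_maximalAtlas x,
    mem_chart_source V x, fun z _ ↦ by simp only [mfld_simps]; rfl⟩

theorem IsImmersiveHom.isImmersion_circle {F : ℝ → G} (hF : IsImmersiveHom I F) {f : Circle → G}
    (hf : ∀ s, f (Circle.exp s) = F s) : Manifold.IsImmersion (𝓡 1) I ∞ f := by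
  refine hF.isImmersion lineEquivEuclidean.symm fun x ↦
    ⟨Circle.argChart (Complex.arg x), Circle.argChart_mem_maximalAtlas _, ?_, fun z hz ↦ ?_⟩
  · simpa using Circle.mem_argChart_source (Complex.arg x)
  · rw [lineEquivEuclidean_symm_apply, ← hf]
    simp [Circle.exp_argChart hz]

theorem IsImmersiveHom.isImmersion_torus {k : ℕ} {F : (Fin k → ℝ) → G} (hF : IsImmersiveHom I F)
    {f : (Fin k → Circle) → G} (hf : ∀ s : Fin k → ℝ, f (fun i ↦ Circle.exp (s i)) = F s) :
    Manifold.IsImmersion (ModelWithCorners.pi fun _ : Fin k ↦ 𝓡 1) I ∞ f := by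
  refine hF.isImmersion (.piCongrRight fun _ ↦ lineEquivEuclidean.symm) fun x ↦
    ⟨OpenPartialHomeomorph.pi fun i ↦ Circle.argChart (Complex.arg (x i)),
      pi_mem_maximalAtlas _ fun i ↦ Circle.argChart_mem_maximalAtlas _, ?_, fun z hz ↦ ?_⟩
  · intro i _
    simpa using Circle.mem_argChart_source (Complex.arg (x i))
  · rw [← hf]
    congr 1
    ext i
    have h := Circle.exp_argChart (hz i (mem_univ i))
    exact congrArg _ h.symm

end ImmersedSubgroups

/-! ### The exponential map of a closed abelian subgroup -/

section AbelianSubgroups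

variable {E : Type*} [NormedAddCommGroup E] [NormedSpace ℝ E]
  {H : Type*} [TopologicalSpace H] {I : ModelWithCorners ℝ E H} [I.Boundaryless]
  {G : Type*} [TopologicalSpace G] [ChartedSpace H G] [Group G] [LieGroup I ∞ G]

/-- Multiplication is differentiable at `(1, 1)`, and with one factor fixed at `1` it is the
identity; so both partial derivatives are the identity. -/
theorem hasFDerivAt_extChartAt_mul_one :
    HasFDerivAt (fun p : E × E ↦ extChartAt I (1 : G)
      ((extChartAt I (1 : G)).symm p.1 * (extChartAt I (1 : G)).symm p.2))
      (ContinuousLinearMap.fst ℝ E E + ContinuousLinearMap.snd ℝ E E)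
      (extChartAt I (1 : G) 1, extChartAt I (1 : G) 1) := by
  set χ := extChartAt I (1 : G) with hχ
  have h1 : (1 : G) ∈ χ.source := mem_extChartAt_source _
  have h1t : χ 1 ∈ χ.target := χ.map_source h1
  have hd := ((contDiffAt_extChartAt_mul (I := I) (G := G) h1t h1t
    (by rw [← hχ, χ.left_inv h1, mul_one]; exact h1)).differentiableAt (by simp)).hasFDerivAt
  rw [← hχ] at hd
  have hn : ∀ᶠ x in 𝓝 (χ 1), x ∈ χ.target :=
    (isOpen_extChartAt_target (I := I) (1 : G)).mem_nhds h1t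
  have hl := HasFDerivAt.comp (f := fun x ↦ (x, χ 1)) (χ 1) hd
    ((hasFDerivAt_id (χ 1)).prodMk (hasFDerivAt_const (χ 1) (χ 1)))
  have hr := HasFDerivAt.comp (f := fun x ↦ (χ 1, x)) (χ 1) hd
    ((hasFDerivAt_const (χ 1) (χ 1)).prodMk (hasFDerivAt_id (χ 1)))
  have hl' := (hl.congr_of_eventuallyEq (f₁ := id) (by
    filter_upwards [hn] with x hx
    simp [χ.left_inv h1, χ.right_inv hx])).unique (hasFDerivAt_id _)
  have hr' := (hr.congr_of_eventuallyEq (f₁ := id) (by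
    filter_upwards [hn] with x hx
    simp [χ.left_inv h1, χ.right_inv hx])).unique (hasFDerivAt_id _)
  refine hd.congr_fderiv (ContinuousLinearMap.ext fun p ↦ ?_)
  have hp : p = (p.1, 0) + (0, p.2) := by simp
  rw [hp, map_add]
  have e1 := DFunLike.congr_fun hl' p.1
  have e2 := DFunLike.congr_fun hr' p.2
  simp only [ContinuousLinearMap.comp_apply, ContinuousLinearMap.prod_apply,
    ContinuousLinearMap.id_apply, zero_apply] at e1 e2
  rw [e1, e2]
  simp

theorem HasMFDerivAt.mul_curves {γ δ : ℝ → G} {v w : E} (hγ1 : γ 0 = 1) (hδ1 : δ 0 = 1)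
    (hγ : HasMFDerivAt 𝓘(ℝ, ℝ) I γ 0 ((1 : ℝ →L[ℝ] ℝ).smulRight v))
    (hδ : HasMFDerivAt 𝓘(ℝ, ℝ) I δ 0 ((1 : ℝ →L[ℝ] ℝ).smulRight w)) :
    HasMFDerivAt 𝓘(ℝ, ℝ) I (fun s ↦ γ s * δ s) 0 ((1 : ℝ →L[ℝ] ℝ).smulRight (v + w)) := by
  have := topologicalGroup_of_lieGroup I ∞ (G := G)
  rw [hasMFDerivAt_iff_hasDerivAt_extChartAt hγ1] at hγ
  rw [hasMFDerivAt_iff_hasDerivAt_extChartAt hδ1] at hδ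
  rw [hasMFDerivAt_iff_hasDerivAt_extChartAt (g := 1) (by simp [hγ1, hδ1])]
  refine ⟨hγ.1.mul hδ.1, ?_⟩
  set χ := extChartAt I (1 : G) with hχ
  have hs : χ.source ∈ 𝓝 (1 : G) := extChartAt_source_mem_nhds _
  have h := hasFDerivAt_extChartAt_mul_one (I := I) (G := G)
  rw [← hχ] at h
  have h2 : HasFDerivAt (fun p : E × E ↦ χ (χ.symm p.1 * χ.symm p.2))
      (ContinuousLinearMap.fst ℝ E E + ContinuousLinearMap.snd ℝ E E)
      (χ (γ 0), χ (δ 0)) := by rwa [hγ1, hδ1]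
  have h3 := h2.comp_hasDerivAt (0 : ℝ) (hγ.2.prodMk hδ.2)
  have h4 : HasDerivAt (fun s ↦ χ (γ s * δ s)) (v + w) 0 := by
    refine (h3.congr_deriv (by simp)).congr_of_eventuallyEq ?_
    filter_upwards [hγ.1.eventually_mem (by rwa [hγ1]), hδ.1.eventually_mem (by rwa [hδ1])]
      with s h5 h6
    simp [χ.left_inv h5, χ.left_inv h6]
  exact h4

variable [FiniteDimensional ℝ E] [T2Space G]

omit [I.Boundaryless] [LieGroup I ∞ G] [FiniteDimensional ℝ E] [T2Space G] in
theorem lieExp_eq_oneParam (w : GroupLieAlgebra I G) : lieExp I w = oneParam I w 1 := by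
  simp [oneParam]

theorem oneParam_zero_left (s : ℝ) : oneParam I (0 : GroupLieAlgebra I G) s = 1 := by
  have h := oneParam_zero (I := I) (G := G) 0
  simpa [oneParam] using h

/-- Commutativity makes the pointwise product a homomorphism; its velocity at `0` is `v + w`, and
the velocity determines it. -/
theorem oneParam_add_left {K : Subgroup G} (hK : ∀ x ∈ K, ∀ y ∈ K, x * y = y * x)
    {v w : GroupLieAlgebra I G} (hv : ∀ t, oneParam I v t ∈ K) (hw : ∀ t, oneParam I w t ∈ K)
    (t : ℝ) : oneParam I (v + w) t = oneParam I v t * oneParam I w t := by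
  have h : oneParam I (v + w) = fun s ↦ oneParam I v s * oneParam I w s := by
    refine oneParam_eq_of_map_add (fun s t ↦ ?_) ?_
    · rw [oneParam_add, oneParam_add, mul_assoc, mul_assoc, ← mul_assoc (oneParam I v t),
        hK _ (hv t) _ (hw s), mul_assoc]
    · exact HasMFDerivAt.mul_curves (oneParam_zero v) (oneParam_zero w)
        (hasMFDerivAt_oneParam_zero v) (hasMFDerivAt_oneParam_zero w)
  exact congrFun h t

variable (I) in
/-- The velocities of the one-parameter subgroups contained in an abelian subgroup. -/
def oneParamSubmodule (K : Subgroup G) (hK : ∀ x ∈ K, ∀ y ∈ K, x * y = y * x) :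
    Submodule ℝ E where
  carrier := {w | ∀ t, oneParam I (w : GroupLieAlgebra I G) t ∈ K}
  add_mem' {v w} hv hw t := by
    have h := oneParam_add_left hK hv hw t
    have h' := K.mul_mem (hv t) (hw t)
    rw [← h] at h'
    exact h'
  zero_mem' t := by
    have h := oneParam_zero_left (I := I) (G := G) t
    have h' := K.one_mem
    rw [← h] at h'
    exact h'
  smul_mem' c w hw t := by
    have h := oneParam_smul (I := I) (G := G) w c t
    have h' : oneParam I (w : GroupLieAlgebra I G) (t * c) ∈ K := hw (t * c)
    rw [← h] at h'
    exact h'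

variable (K : Subgroup G) (hK : ∀ x ∈ K, ∀ y ∈ K, x * y = y * x)

theorem lieExp_oneParamSubmodule_add (x y : oneParamSubmodule I K hK) :
    lieExp (G := G) I ((x + y : oneParamSubmodule I K hK) : E) =
      lieExp (G := G) I (x : E) * lieExp (G := G) I (y : E) := by
  have h := oneParam_add_left (I := I) (G := G) hK x.2 y.2 1
  have e := fun w : E ↦ lieExp_eq_oneParam (I := I) (G := G) w
  exact (e _).trans (h.trans (congrArg₂ (· * ·) (e _).symm (e _).symm))

/-- In a basis, additivity writes the exponential as a product of one-parameter groups evaluated at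
the coordinates, so smoothness in the time variable suffices. -/
theorem contMDiff_lieExp_oneParamSubmodule :
    ContMDiff 𝓘(ℝ, oneParamSubmodule I K hK) I ∞
      (fun w : oneParamSubmodule I K hK ↦ lieExp (G := G) I (w : E)) := by
  set F := fun w : oneParamSubmodule I K hK ↦ lieExp (G := G) I (w : E) with hF
  have hadd : ∀ x y, F (x + y) = F x * F y := lieExp_oneParamSubmodule_add (I := I) K hK
  have hF0 : F 0 = 1 := by simpa using hadd 0 0
  let b := Module.finBasis ℝ (oneParamSubmodule I K hK)
  have h : ∀ s : Finset (Fin (Module.finrank ℝ (oneParamSubmodule I K hK))),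
      ContMDiff 𝓘(ℝ, oneParamSubmodule I K hK) I ∞ fun w ↦ F (∑ i ∈ s, b.repr w i • b i) := by
    intro s
    induction s using Finset.induction_on with
    | empty => simpa [hF0] using contMDiff_const
    | insert i s hi ih =>
      simp only [Finset.sum_insert hi, hadd]
      refine ContMDiff.mul ?_ ih
      have h1 : ContDiff ℝ ∞ fun w ↦ b.repr w i :=
        (LinearMap.toContinuousLinearMap (b.coord i)).contDiff
      exact (contMDiff_oneParam (I := I) (G := G) ((b i : E) : GroupLieAlgebra I G)).comp
        h1.contMDiff
  simpa [b.sum_repr] using h Finset.univ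

theorem hasMFDerivAt_lieExp_oneParamSubmodule :
    HasMFDerivAt 𝓘(ℝ, oneParamSubmodule I K hK) I
      (fun w : oneParamSubmodule I K hK ↦ lieExp (G := G) I (w : E)) 0
      (oneParamSubmodule I K hK).subtypeL := by
  set F := fun w : oneParamSubmodule I K hK ↦ lieExp (G := G) I (w : E) with hF
  have hsm := (contMDiff_lieExp_oneParamSubmodule (I := I) K hK).mdifferentiable (by simp) 0
  have hd : ∀ w : oneParamSubmodule I K hK,
      (mfderiv 𝓘(ℝ, oneParamSubmodule I K hK) I F 0 : _ →L[ℝ] E) w = (w : E) := by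
    intro w
    have h1 : HasMFDerivAt 𝓘(ℝ, oneParamSubmodule I K hK) I F ((0 : ℝ) • w)
        (mfderiv 𝓘(ℝ, oneParamSubmodule I K hK) I F 0) := by
      rw [zero_smul]; exact hsm.hasMFDerivAt
    have h2 : HasMFDerivAt 𝓘(ℝ, ℝ) 𝓘(ℝ, oneParamSubmodule I K hK) (fun s : ℝ ↦ s • w) 0
        ((1 : ℝ →L[ℝ] ℝ).smulRight w) :=
      (((1 : ℝ →L[ℝ] ℝ).smulRight w).hasFDerivAt).hasMFDerivAt
    have h3 := HasMFDerivAt.comp (f := fun s : ℝ ↦ s • w) (0 : ℝ) h1 h2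
    have h4 := hasMFDerivAt_oneParam_zero (I := I) (G := G) ((w : E) : GroupLieAlgebra I G)
    have h5 := hasMFDerivAt_unique h3 h4
    have h6 := DFunLike.congr_fun h5 (1 : ℝ)
    change (mfderiv 𝓘(ℝ, oneParamSubmodule I K hK) I F 0 : _ →L[ℝ] E) ((1 : ℝ) • w) =
      (1 : ℝ) • (w : E) at h6
    rwa [one_smul, one_smul] at h6
  have h := hsm.hasMFDerivAt
  rwa [show mfderiv 𝓘(ℝ, oneParamSubmodule I K hK) I F 0 =
    (oneParamSubmodule I K hK).subtypeL from ContinuousLinearMap.ext hd] at h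

theorem isImmersiveHom_lieExp :
    IsImmersiveHom I
      (fun w : oneParamSubmodule I K hK ↦ lieExp (G := G) I (w : E)) where
  contMDiff := contMDiff_lieExp_oneParamSubmodule (I := I) K hK
  map_add := lieExp_oneParamSubmodule_add (I := I) K hK
  injective_mfderiv := by
    rw [(hasMFDerivAt_lieExp_oneParamSubmodule K hK).mfderiv]
    exact Subtype.val_injective

theorem lieExp_mem (v : oneParamSubmodule I K hK) : lieExp (G := G) I (v : E) ∈ K := by
  have h := lieExp_eq_oneParam (I := I) (G := G) (v : E)
  have h' : oneParam I ((v : E) : GroupLieAlgebra I G) 1 ∈ K := v.2 1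
  rw [← h] at h'
  exact h'

end AbelianSubgroups

/-! ### Limits of directions in a closed subgroup -/

section LimitDirections

variable {E : Type*} [NormedAddCommGroup E] [NormedSpace ℝ E]
  {H : Type*} [TopologicalSpace H] {I : ModelWithCorners ℝ E H} [I.Boundaryless]
  {G : Type*} [TopologicalSpace G] [ChartedSpace H G] [Group G] [LieGroup I ∞ G]

theorem contMDiffAt_extChartAt_one_symm :
    ContMDiffAt 𝓘(ℝ, E) I ∞ (extChartAt I (1 : G)).symm (extChartAt I (1 : G) 1) :=
  (contMDiffOn_extChartAt_symm (I := I) (n := ∞) (1 : G)).contMDiffAt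
    (extChartAt_target_mem_nhds (I := I) (1 : G))

/-- In the chart, `(x, y) ↦ x⁻¹ * y` is Lipschitz near the identity and constant on the diagonal;
compare `(x, y)` with `(x, x)`. -/
theorem exists_norm_extChartAt_inv_mul_le : ∃ C : ℝ, ∀ᶠ p in 𝓝 ((1, 1) : G × G),
    ‖extChartAt I (1 : G) (p.1⁻¹ * p.2) - extChartAt I (1 : G) 1‖ ≤
      C * ‖extChartAt I (1 : G) p.1 - extChartAt I (1 : G) p.2‖ := by
  have := topologicalGroup_of_lieGroup I ∞ (G := G)
  set χ := extChartAt I (1 : G) with hχ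
  have h1 : (1 : G) ∈ χ.source := mem_extChartAt_source _
  have hsymm : ContMDiffAt 𝓘(ℝ, E) I ∞ χ.symm (χ 1) := contMDiffAt_extChartAt_one_symm
  have hR : ContDiffAt ℝ ∞ (fun p : E × E ↦ χ ((χ.symm p.1)⁻¹ * χ.symm p.2)) (χ 1, χ 1) := by
    rw [← contMDiffAt_iff_contDiffAt]
    have hp : ContMDiffAt 𝓘(ℝ, E × E) I ∞ (fun p : E × E ↦ (χ.symm p.1)⁻¹ * χ.symm p.2)
        (χ 1, χ 1) := by
      refine ContMDiffAt.mul (ContMDiffAt.inv ?_) ?_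
      · exact ContMDiffAt.comp (χ 1, χ 1) (g := χ.symm) (f := Prod.fst)
          hsymm contDiff_fst.contMDiff.contMDiffAt
      · exact ContMDiffAt.comp (χ 1, χ 1) (g := χ.symm) (f := Prod.snd)
          hsymm contDiff_snd.contMDiff.contMDiffAt
    refine ContMDiffAt.comp (χ 1, χ 1) (g := χ) ?_ hp
    exact contMDiffAt_extChartAt' (by simp [χ.left_inv h1])
  obtain ⟨C, s, hs, hC⟩ := (hR.of_le (m := 1) (by simp)).exists_lipschitzOnWith
  refine ⟨C, ?_⟩
  have hχc : ContinuousAt χ (1 : G) := continuousAt_extChartAt _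
  have hsrc : ∀ᶠ x in 𝓝 (1 : G), x ∈ χ.source := extChartAt_source_mem_nhds _
  have hf : Tendsto (fun p : G × G ↦ p.1) (𝓝 (1, 1)) (𝓝 1) := continuous_fst.tendsto _
  have hg : Tendsto (fun p : G × G ↦ p.2) (𝓝 (1, 1)) (𝓝 1) := continuous_snd.tendsto _
  have hl : Tendsto (fun p : G × G ↦ (χ p.1, χ p.2)) (𝓝 (1, 1)) (𝓝 (χ 1, χ 1)) :=
    (hχc.tendsto.comp hf).prodMk_nhds (hχc.tendsto.comp hg)
  have hr : Tendsto (fun p : G × G ↦ (χ p.1, χ p.1)) (𝓝 (1, 1)) (𝓝 (χ 1, χ 1)) :=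
    (hχc.tendsto.comp hf).prodMk_nhds (hχc.tendsto.comp hf)
  filter_upwards [hf.eventually hsrc, hg.eventually hsrc, hl hs, hr hs] with p h2 h3 h4 h5
  have h6 := hC.norm_sub_le h4 h5
  simp only [χ.left_inv h2, χ.left_inv h3, inv_mul_cancel] at h6
  refine h6.trans_eq ?_
  rw [Prod.mk_sub_mk, sub_self, Prod.norm_mk, norm_zero, max_eq_right (norm_nonneg _), norm_sub_rev]

variable [FiniteDimensional ℝ E] [T2Space G]

/-- The expression is Lipschitz in the chart and reduces to `e` when `a = 1`. The coefficient of the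
error of `e` is exactly `1`, so errors add up under iteration instead of compounding. -/
theorem exists_norm_extChartAt_conj_mul_le (w : GroupLieAlgebra I G) :
    ∃ C : ℝ, 0 ≤ C ∧ ∃ δ > 0, ∀ (s : ℝ) (a e : G), |s| < δ →
      a ∈ (extChartAt I (1 : G)).source → e ∈ (extChartAt I (1 : G)).source →
      ‖extChartAt I (1 : G) a - extChartAt I (1 : G) 1‖ < δ →
      ‖extChartAt I (1 : G) e - extChartAt I (1 : G) 1‖ < δ →
      oneParam I w (-s) * a * oneParam I w s * e ∈ (extChartAt I (1 : G)).source ∧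
      ‖extChartAt I (1 : G) (oneParam I w (-s) * a * oneParam I w s * e) -
        extChartAt I (1 : G) 1‖ ≤ ‖extChartAt I (1 : G) e - extChartAt I (1 : G) 1‖ +
          C * ‖extChartAt I (1 : G) a - extChartAt I (1 : G) 1‖ := by
  set χ := extChartAt I (1 : G) with hχ
  set γ := oneParam I w with hγ
  have hγ0 : γ 0 = 1 := oneParam_zero w
  have h1 : (1 : G) ∈ χ.source := mem_extChartAt_source _
  have hsymm : ContMDiffAt 𝓘(ℝ, E) I ∞ χ.symm (χ 1) := contMDiffAt_extChartAt_one_symm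
  let P : ℝ × E × E → G := fun p ↦ γ (-p.1) * χ.symm p.2.1 * γ p.1 * χ.symm p.2.2
  have hP : ContMDiffAt 𝓘(ℝ, ℝ × E × E) I ∞ P (0, χ 1, χ 1) := by
    refine ContMDiffAt.mul (ContMDiffAt.mul (ContMDiffAt.mul ?_ ?_) ?_) ?_
    · exact ((contMDiff_oneParam w).comp contDiff_fst.neg.contMDiff).contMDiffAt
    · exact ContMDiffAt.comp (0, χ 1, χ 1) (g := χ.symm) (f := fun p : ℝ × E × E ↦ p.2.1)
        hsymm (contDiff_fst.comp contDiff_snd).contMDiff.contMDiffAt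
    · exact ((contMDiff_oneParam w).comp contDiff_fst.contMDiff).contMDiffAt
    · exact ContMDiffAt.comp (0, χ 1, χ 1) (g := χ.symm) (f := fun p : ℝ × E × E ↦ p.2.2)
        hsymm (contDiff_snd.comp contDiff_snd).contMDiff.contMDiffAt
  have hP1 : P (0, χ 1, χ 1) = 1 := by simp [P, hγ0, χ.left_inv h1]
  have hQ : ContDiffAt ℝ ∞ (fun p ↦ χ (P p)) (0, χ 1, χ 1) := by
    rw [← contMDiffAt_iff_contDiffAt]
    refine ContMDiffAt.comp (0, χ 1, χ 1) (g := χ) ?_ hP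
    exact contMDiffAt_extChartAt' (by rw [hP1]; simp)
  obtain ⟨C, S, hS, hC⟩ := (hQ.of_le (m := 1) (by simp)).exists_lipschitzOnWith
  have hsrc : P ⁻¹' χ.source ∈ 𝓝 ((0, χ 1, χ 1) : ℝ × E × E) :=
    hP.continuousAt.preimage_mem_nhds (by rw [hP1]; exact extChartAt_source_mem_nhds _)
  obtain ⟨δ, hδ, hball⟩ := Metric.mem_nhds_iff.1 (inter_mem hS hsrc)
  refine ⟨C, C.2, δ, hδ, fun s a e hs ha he had hed ↦ ?_⟩
  have hmem : ∀ x : E, ‖x - χ 1‖ < δ → ((s, x, χ e) : ℝ × E × E) ∈ S ∩ P ⁻¹' χ.source :=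
    fun x hx ↦ hball (by
      rw [Metric.mem_ball, dist_eq_norm]
      simp only [Prod.mk_sub_mk, sub_zero, Prod.norm_mk, Real.norm_eq_abs]
      exact max_lt hs (max_lt hx hed))
  have m1 := hmem (χ a) had
  have m2 := hmem (χ 1) (by simpa using hδ)
  have e1 : P (s, χ a, χ e) = γ (-s) * a * γ s * e := by
    simp only [P, χ.left_inv ha, χ.left_inv he]
  have e2 : P (s, χ 1, χ e) = e := by
    simp only [P, χ.left_inv h1, χ.left_inv he, mul_one]
    rw [hγ, ← oneParam_add, neg_add_cancel, oneParam_zero, one_mul]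
  refine ⟨e1 ▸ m1.2, ?_⟩
  have h6 := hC.norm_sub_le m1.1 m2.1
  simp only [e1, e2, Prod.mk_sub_mk, sub_self, Prod.norm_mk, norm_zero] at h6
  rw [max_eq_left (norm_nonneg (χ a - χ 1)), max_eq_right (norm_nonneg (χ a - χ 1))] at h6
  calc _ = ‖(χ e - χ 1) + (χ (γ (-s) * a * γ s * e) - χ e)‖ := by congr 1; abel
    _ ≤ _ := (norm_add_le _ _).trans (by gcongr)

theorem mem_of_forall_small {K : Subgroup G} {w : GroupLieAlgebra I G} {δ : ℝ} (hδ : 0 < δ)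
    (h : ∀ t, 0 ≤ t → t < δ → oneParam I w t ∈ K) (t : ℝ) : oneParam I w t ∈ K := by
  have hpow : ∀ (s : ℝ) (n : ℕ), oneParam I w (n * s) = oneParam I w s ^ n := by
    intro s n
    induction n with
    | zero => simp [oneParam_zero]
    | succ n ih => rw [pow_succ, ← ih, ← oneParam_add]; push_cast; ring_nf
  have hnn : ∀ t, 0 ≤ t → oneParam I w t ∈ K := by
    intro t ht
    obtain ⟨n, hn⟩ := exists_nat_gt (t / δ)
    have hn0 : (0 : ℝ) < n := (div_nonneg ht hδ.le).trans_lt hn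
    have h1 := h (t / n) (div_nonneg ht hn0.le) (by
      rw [div_lt_iff₀ hn0]; rwa [div_lt_iff₀ hδ, mul_comm] at hn)
    have h2 := K.pow_mem h1 n
    rwa [← hpow, mul_div_cancel₀ _ hn0.ne'] at h2
  rcases le_total 0 t with ht | ht
  · exact hnn t ht
  · have h1 : oneParam I w t * oneParam I w (-t) = 1 := by
      rw [← oneParam_add, add_neg_cancel, oneParam_zero]
    rw [eq_inv_of_mul_eq_one_left h1]
    exact K.inv_mem (hnn _ (by linarith))

/-- With `m = ⌊t / τ⌋`, the powers `h ^ m` lie in `K` and converge to `γ t`. Indeed `h = γ τ * a`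
with `a` at distance `o(τ)` from `1`, and `m` factors contribute an error of order `m * o(τ)`, which
tends to `0`. -/
theorem oneParam_mem_of_tendsto {K : Subgroup G} (hK : IsClosed (K : Set G))
    {h : ℕ → G} (hh : ∀ n, h n ∈ K) (h1 : Tendsto h atTop (𝓝 1)) {τ : ℕ → ℝ}
    (hτ : ∀ n, 0 < τ n) (hτ0 : Tendsto τ atTop (𝓝 0)) {w : GroupLieAlgebra I G}
    (hw : Tendsto (fun n ↦ (τ n)⁻¹ • (extChartAt I (1 : G) (h n) - extChartAt I (1 : G) 1)) atTop
      (𝓝 (w : E))) (t : ℝ) :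
    oneParam I w t ∈ K := by
  have := topologicalGroup_of_lieGroup I ∞ (G := G)
  obtain ⟨C, hC0, δ, hδ, hC⟩ := exists_norm_extChartAt_conj_mul_le w
  obtain ⟨C', hC'⟩ := exists_norm_extChartAt_inv_mul_le (I := I) (G := G)
  -- Restricting to `t < δ` keeps every time `j * τ n` within the range of the conjugation estimate.
  refine mem_of_forall_small hδ (fun t ht htδ ↦ ?_) t
  set χ := extChartAt I (1 : G) with hχ
  set γ := oneParam I w with hγ
  have hγ0 : γ 0 = 1 := oneParam_zero w
  have hγc : Continuous γ := continuous_oneParam w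
  have hγτ : Tendsto (fun n ↦ γ (τ n)) atTop (𝓝 1) := by
    have := (hγc.tendsto 0).comp hτ0
    rwa [hγ0] at this
  let a : ℕ → G := fun n ↦ (γ (τ n))⁻¹ * h n
  have ha : Tendsto a atTop (𝓝 1) := by simpa using hγτ.inv.mul h1
  let ε : ℕ → ℝ := fun n ↦ ‖χ (a n) - χ 1‖
  let m : ℕ → ℕ := fun n ↦ ⌊t / τ n⌋₊
  have hmτ : ∀ n, m n * τ n ≤ t := fun n ↦
    (le_div_iff₀ (hτ n)).1 (Nat.floor_le (div_nonneg ht (hτ n).le))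
  -- Both `γ (τ n)` and `h n` leave `1` with velocity `w`, so they differ by `o(τ n)`, and `C'`
  -- passes this on to `a n`.
  have hε0 : Tendsto (fun n ↦ (τ n)⁻¹ * ε n) atTop (𝓝 0) := by
    have hd : HasDerivAt (fun s ↦ χ (γ s)) w 0 :=
      ((hasMFDerivAt_iff_hasDerivAt_extChartAt hγ0).1 (hasMFDerivAt_oneParam_zero w)).2
    have hs : Tendsto (fun n ↦ (τ n)⁻¹ • (χ (γ (τ n)) - χ 1)) atTop (𝓝 (w : E)) := by
      have h2 := hd.tendsto_slope_zero.comp (tendsto_nhdsWithin_iff.2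
        ⟨hτ0, Eventually.of_forall fun n ↦ (hτ n).ne'⟩)
      simpa [Function.comp_def, hγ0] using h2
    have h3 : Tendsto (fun n ↦ (τ n)⁻¹ • (χ (γ (τ n)) - χ (h n))) atTop (𝓝 0) := by
      have h2 : Tendsto (fun n ↦ (τ n)⁻¹ • (χ (γ (τ n)) - χ 1) - (τ n)⁻¹ • (χ (h n) - χ 1))
          atTop (𝓝 0) := (hs.sub hw).trans_eq (congrArg 𝓝 (sub_self (G := E) w))
      refine h2.congr fun n ↦ ?_
      rw [← smul_sub]; congr 1; abel
    have h4 := (h3.norm.const_mul C')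
    rw [norm_zero, mul_zero] at h4
    refine squeeze_zero' (Eventually.of_forall fun n ↦ mul_nonneg (inv_nonneg.2 (hτ n).le)
      (norm_nonneg _)) ?_ h4
    filter_upwards [(hγτ.prodMk_nhds h1).eventually hC'] with n hn
    rw [norm_smul, Real.norm_of_nonneg (inv_nonneg.2 (hτ n).le), mul_left_comm]
    exact mul_le_mul_of_nonneg_left hn (inv_nonneg.2 (hτ n).le)
  have hmε : Tendsto (fun n ↦ m n * (C * ε n)) atTop (𝓝 0) := by
    have h2 := (hε0.const_mul (t * C))
    rw [mul_zero] at h2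
    refine squeeze_zero (fun n ↦ by positivity) (fun n ↦ ?_) h2
    have h3 : (m n : ℝ) ≤ t * (τ n)⁻¹ := Nat.floor_le (div_nonneg ht (hτ n).le)
    calc m n * (C * ε n) ≤ (t * (τ n)⁻¹) * (C * ε n) := by gcongr
      _ = _ := by ring
  have hεδ : ∀ᶠ n in atTop, ε n < δ := by
    have h2 : Tendsto ε atTop (𝓝 0) := by
      have := ((continuousAt_extChartAt (I := I) (1 : G)).tendsto.comp ha).sub_const (χ 1)
      rw [← hχ, sub_self] at this
      simpa only [norm_zero, Function.comp_apply] using this.norm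
    exact h2.eventually (gt_mem_nhds hδ)
  have hasrc : ∀ᶠ n in atTop, a n ∈ χ.source := ha.eventually_mem (extChartAt_source_mem_nhds _)
  have key : ∀ᶠ n in atTop, γ (-(m n * τ n)) * h n ^ m n ∈ χ.source ∧
      ‖χ (γ (-(m n * τ n)) * h n ^ m n) - χ 1‖ ≤ m n * (C * ε n) := by
    filter_upwards [hεδ, hasrc, hmε.eventually (gt_mem_nhds hδ)] with n h2 h3 h4
    -- Each step multiplies by a conjugate of `a n` and adds at most `C * ε n`; since `m n * (C * ε
    -- n) < δ`, the estimate stays applicable up to `j = m n`.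
    have hj : ∀ j ≤ m n, γ (-(j * τ n)) * h n ^ j ∈ χ.source ∧
        ‖χ (γ (-(j * τ n)) * h n ^ j) - χ 1‖ ≤ j * (C * ε n) := by
      intro j
      induction j with
      | zero => intro _; simp [hγ0, hχ]
      | succ j ih =>
        intro hjm
        obtain ⟨i1, i2⟩ := ih (by omega)
        have hjm' : (j : ℝ) ≤ m n := by exact_mod_cast (by omega : j ≤ m n)
        have hjs : |(j : ℝ) * τ n| < δ := by
          rw [abs_of_nonneg (mul_nonneg j.cast_nonneg (hτ n).le)]
          exact ((mul_le_mul_of_nonneg_right hjm' (hτ n).le).trans (hmτ n)).trans_lt htδ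
        have hCε : 0 ≤ C * ε n := mul_nonneg hC0 (norm_nonneg _)
        have h5 := hC (j * τ n) (a n) _ hjs h3 i1 h2
          (i2.trans_lt ((mul_le_mul_of_nonneg_right hjm' hCε).trans_lt h4))
        have h6 : γ (-(j * τ n)) * a n * γ (j * τ n) * (γ (-(j * τ n)) * h n ^ j) =
            γ (-((j + 1 : ℕ) * τ n)) * h n ^ (j + 1) := by
          have h7 : γ (j * τ n) * γ (-(j * τ n)) = 1 := by
            rw [hγ, ← oneParam_add, add_neg_cancel, oneParam_zero]
          have h8 : (γ (τ n))⁻¹ = γ (-τ n) := by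
            rw [inv_eq_iff_mul_eq_one, hγ, ← oneParam_add, add_neg_cancel, oneParam_zero]
          have h9 : γ (-((j + 1 : ℕ) * τ n)) = γ (-(j * τ n)) * γ (-τ n) := by
            rw [hγ, ← oneParam_add]; push_cast; ring_nf
          rw [h9, pow_succ']
          simp only [a, h8]
          calc _ = γ (-(j * τ n)) * γ (-τ n) * h n * (γ (j * τ n) * γ (-(j * τ n))) * h n ^ j := by
                simp only [mul_assoc]
            _ = _ := by rw [h7]; simp only [mul_assoc, one_mul]
        rw [h6] at h5
        refine ⟨h5.1, h5.2.trans ?_⟩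
        push_cast
        linarith
    exact hj _ le_rfl
  have hlim : Tendsto (fun n ↦ γ (-(m n * τ n)) * h n ^ m n) atTop (𝓝 1) := by
    have h2 : Tendsto (fun n ↦ χ (γ (-(m n * τ n)) * h n ^ m n)) atTop (𝓝 (χ 1)) := by
      rw [tendsto_iff_norm_sub_tendsto_zero]
      exact squeeze_zero' (Eventually.of_forall fun n ↦ norm_nonneg _)
        (key.mono fun n hn ↦ hn.2) hmε
    have h3 := (continuousAt_extChartAt_symm (I := I) (1 : G)).tendsto.comp h2
    rw [extChartAt_to_inv] at h3
    exact h3.congr' (key.mono fun n hn ↦ χ.left_inv hn.1)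
  have hmt : Tendsto (fun n ↦ (m n : ℝ) * τ n) atTop (𝓝 t) := by
    have h2 : Tendsto (fun n ↦ t - τ n) atTop (𝓝 t) := by simpa using hτ0.const_sub t
    refine tendsto_of_tendsto_of_tendsto_of_le_of_le h2 tendsto_const_nhds (fun n ↦ ?_) hmτ
    have h3 := Nat.lt_floor_add_one (t / τ n)
    rw [div_lt_iff₀ (hτ n)] at h3
    simp only [m]
    linarith
  have hfin : Tendsto (fun n ↦ h n ^ m n) atTop (𝓝 (γ t)) := by
    have h2 := ((hγc.tendsto t).comp hmt).mul hlim
    rw [mul_one] at h2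
    refine h2.congr fun n ↦ ?_
    rw [Function.comp_apply, ← mul_assoc, hγ, ← oneParam_add, add_neg_cancel, oneParam_zero,
      one_mul]
  exact hK.mem_of_tendsto hfin (Eventually.of_forall fun n ↦ K.pow_mem (hh n) _)

end LimitDirections

/-! ### The closed subgroup theorem -/

section OpenMapping

variable {E : Type*} [NormedAddCommGroup E] [NormedSpace ℝ E]
  {H : Type*} [TopologicalSpace H] {I : ModelWithCorners ℝ E H}
  {G : Type*} [TopologicalSpace G] [ChartedSpace H G] [Group G]

theorem HasFDerivAt.eventually_ne_of_injective {V : Type*} [NormedAddCommGroup V] [NormedSpace ℝ V]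
    [FiniteDimensional ℝ V] {f : V → E} {A : V →L[ℝ] E} {x : V} (hf : HasFDerivAt f A x)
    (hA : Function.Injective A) (c : E) : ∀ᶠ z in 𝓝[≠] x, f z ≠ c := by
  obtain ⟨C, _, hC⟩ := LinearMap.exists_antilipschitzWith (A : V →ₗ[ℝ] E)
    (LinearMap.ker_eq_bot.2 hA)
  exact hf.eventually_ne ⟨C, hC⟩

theorem IsImmersiveHom.eventually_ne_one {V : Type*} [NormedAddCommGroup V] [NormedSpace ℝ V]
    [FiniteDimensional ℝ V] {F : V → G} (hF : IsImmersiveHom I F) :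
    ∀ᶠ x in 𝓝[≠] (0 : V), F x ≠ 1 := by
  have h := (hF.contMDiff.mdifferentiable (by simp) 0).hasMFDerivAt.hasFDerivAt_extChartAt
  rw [hF.map_zero] at h
  exact (h.eventually_ne_of_injective hF.injective_mfderiv _).mono fun x hx hx1 ↦ hx (by rw [hx1])

variable [I.Boundaryless] [LieGroup I ∞ G]

theorem contMDiffAt_mul_complement {V W : Type*} [NormedAddCommGroup V] [NormedSpace ℝ V]
    [NormedAddCommGroup W] [NormedSpace ℝ W] {F : V → G} (hF : IsImmersiveHom I F) (B : W →L[ℝ] E) :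
    ContMDiffAt 𝓘(ℝ, V × W) I ∞
      (fun p : V × W ↦ F p.1 * (extChartAt I (1 : G)).symm (extChartAt I (1 : G) 1 + B p.2))
      0 := by
  refine ContMDiffAt.mul (hF.contMDiff.comp contDiff_fst.contMDiff).contMDiffAt ?_
  refine ContMDiffAt.comp (0 : V × W) (g := (extChartAt I (1 : G)).symm)
    (f := fun p : V × W ↦ extChartAt I (1 : G) 1 + B p.2) ?_
    (contDiff_const.add (B.contDiff.comp contDiff_snd)).contMDiff.contMDiffAt
  rw [Prod.snd_zero, map_zero, add_zero]
  exact contMDiffAt_extChartAt_one_symm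

/-- These are coordinates on `G` adapted to the image of `F`: since multiplication differentiates to
addition at the identity, the derivative is `A` plus `B`. -/
theorem hasStrictFDerivAt_mul_complement {V W : Type*} [NormedAddCommGroup V] [NormedSpace ℝ V]
    [NormedAddCommGroup W] [NormedSpace ℝ W] {F : V → G} (hF : IsImmersiveHom I F) {A : V →L[ℝ] E}
    (hA : HasMFDerivAt 𝓘(ℝ, V) I F 0 A) (B : W →L[ℝ] E) :
    HasStrictFDerivAt (fun p : V × W ↦ extChartAt I (1 : G)
      (F p.1 * (extChartAt I (1 : G)).symm (extChartAt I (1 : G) 1 + B p.2)))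
      (A.comp (ContinuousLinearMap.fst ℝ V W) + B.comp (ContinuousLinearMap.snd ℝ V W)) 0 := by
  have hP := contMDiffAt_mul_complement hF B
  have hd := hA.hasFDerivAt_extChartAt
  have hm := hasFDerivAt_extChartAt_mul_one (I := I) (G := G)
  have h6 : ∀ᶠ p in 𝓝 (0 : V × W), F p.1 ∈ (extChartAt I (1 : G)).source :=
    (hF.continuous.comp continuous_fst).continuousAt.eventually_mem (by
      rw [Function.comp_apply, Prod.fst_zero, hF.map_zero]
      exact extChartAt_source_mem_nhds (I := I) (1 : G))
  have hcm : ContMDiffAt I 𝓘(ℝ, E) ∞ (extChartAt I (1 : G)) 1 := contMDiffAt_extChartAt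
  have h1 : (1 : G) ∈ (extChartAt I (1 : G)).source := mem_extChartAt_source _
  rw [hF.map_zero] at hd
  generalize extChartAt I (1 : G) = χ at *
  have hQ : ContDiffAt ℝ ∞ (fun p : V × W ↦ χ (F p.1 * χ.symm (χ 1 + B p.2))) 0 := by
    rw [← contMDiffAt_iff_contDiffAt]
    refine ContMDiffAt.comp (0 : V × W) (g := χ) ?_ hP
    simpa [hF.map_zero, χ.left_inv h1] using hcm
  refine hQ.hasStrictFDerivAt' ?_ (by simp)
  have h2 : HasFDerivAt (fun u ↦ χ (F u)) A (0 : V × W).1 := hd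
  have h3 : HasFDerivAt (fun p : V × W ↦ χ (F p.1)) _ (0 : V × W) := h2.comp 0 hasFDerivAt_fst
  have h4 : HasFDerivAt (fun p : V × W ↦ χ 1 + B p.2) (B.comp (ContinuousLinearMap.snd ℝ V W))
      (0 : V × W) := (B.hasFDerivAt.comp (0 : V × W) hasFDerivAt_snd).const_add _
  have hm' : HasFDerivAt (fun p : E × E ↦ χ (χ.symm p.1 * χ.symm p.2))
      (ContinuousLinearMap.fst ℝ E E + ContinuousLinearMap.snd ℝ E E)
      (χ (F (0 : V × W).1), χ 1 + B (0 : V × W).2) := by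
    simpa [hF.map_zero] using hm
  have h5 := HasFDerivAt.comp (f := fun p : V × W ↦ (χ (F p.1), χ 1 + B p.2)) (0 : V × W) hm'
    (h3.prodMk h4)
  refine (h5.congr_of_eventuallyEq ?_).congr_fderiv ?_
  · filter_upwards [h6] with p hp
    simp [χ.left_inv hp]
  · ext p <;> simp

/-- Elements of a subgroup near the identity that are not of the form `F v` with `v` small have,
after translation, a nonzero component in the complementary directions. -/
theorem exists_seq_complement {V W : Type*} [NormedAddCommGroup V] [NormedSpace ℝ V]
    [CompleteSpace V] [NormedAddCommGroup W] [NormedSpace ℝ W] [CompleteSpace W]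
    {F : V → G} (hF : IsImmersiveHom I F) {A : V →L[ℝ] E}
    (hA : HasMFDerivAt 𝓘(ℝ, V) I F 0 A) (B : W →L[ℝ] E) (T : (V × W) ≃L[ℝ] E)
    (hT : ∀ p, T p = A p.1 + B p.2) (K : Subgroup G) (hFK : ∀ v, F v ∈ K) {S : Set G}
    (hS : F ⁻¹' S ∈ 𝓝 0) (hSK : S ∉ 𝓝[(K : Set G)] 1) :
    ∃ w : ℕ → W, (∀ n, w n ≠ 0) ∧ Tendsto w atTop (𝓝 0) ∧ ∀ n,
      extChartAt I (1 : G) 1 + B (w n) ∈ (extChartAt I (1 : G)).target ∧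
      (extChartAt I (1 : G)).symm (extChartAt I (1 : G) 1 + B (w n)) ∈ K := by
  have hP := contMDiffAt_mul_complement hF B
  have hQ := hasStrictFDerivAt_mul_complement hF hA B
  have hT' : (T : _ →L[ℝ] E) = A.comp (ContinuousLinearMap.fst ℝ _ _) +
      B.comp (ContinuousLinearMap.snd ℝ _ _) := ContinuousLinearMap.ext fun p ↦ hT p
  rw [← hT'] at hQ
  have h1 : (1 : G) ∈ (extChartAt I (1 : G)).source := mem_extChartAt_source _
  have hsrc : (extChartAt I (1 : G)).source ∈ 𝓝 (1 : G) := extChartAt_source_mem_nhds _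
  have htgt : (extChartAt I (1 : G)).target ∈ 𝓝 (extChartAt I (1 : G) 1) :=
    extChartAt_target_mem_nhds _
  have hχc : ContinuousAt (extChartAt I (1 : G)) 1 := continuousAt_extChartAt _
  generalize extChartAt I (1 : G) = χ at *
  have hmap := hQ.map_nhds_eq_of_equiv
  simp only [Prod.fst_zero, hF.map_zero, Prod.snd_zero, map_zero, add_zero, χ.left_inv h1,
    mul_one] at hmap
  have hBt : Tendsto (fun p : V × W ↦ χ 1 + B p.2) (𝓝 0) (𝓝 (χ 1)) := by
    have : Continuous (fun p : V × W ↦ χ 1 + B p.2) := by fun_prop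
    simpa using this.tendsto 0
  have hex : ∀ n : ℕ, ∃ p : V × W, F p.1 ∈ S ∧ ‖p.2‖ < 1 / (n + 1) ∧
      χ 1 + B p.2 ∈ χ.target ∧ F p.1 * χ.symm (χ 1 + B p.2) ∈ K ∧
      F p.1 * χ.symm (χ 1 + B p.2) ∉ S := by
    intro n
    have e1 : ∀ᶠ p : V × W in 𝓝 0, F p.1 ∈ S :=
      (continuous_fst.tendsto (0 : V × W)).eventually hS
    have e2 : ∀ᶠ p : V × W in 𝓝 0, ‖p.2‖ < 1 / ((n : ℝ) + 1) :=
      (continuous_snd.norm.tendsto (0 : V × W)).eventually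
        (gt_mem_nhds (by rw [Prod.snd_zero, norm_zero]; positivity))
    have e4 := hP.continuousAt.eventually_mem (s := χ.source) (by
      rw [Prod.fst_zero, hF.map_zero, Prod.snd_zero, map_zero, add_zero, χ.left_inv h1, mul_one]
      exact hsrc)
    have hN := image_mem_map (m := fun p : V × W ↦
      χ (F p.1 * χ.symm (χ 1 + B p.2))) (e1.and (e2.and ((hBt.eventually htgt).and e4)))
    rw [hmap] at hN
    -- Without such a point, every element of `K` near `1` would lie in `S`, by surjectivity of the
    -- coordinates near `1`.
    by_contra hno
    push Not at hno
    refine hSK ?_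
    filter_upwards [mem_nhdsWithin_of_mem_nhds (hχc.preimage_mem_nhds hN),
      mem_nhdsWithin_of_mem_nhds hsrc, self_mem_nhdsWithin] with k hk1 hk2 hk3
    obtain ⟨p, ⟨p1, p2, p3, p4⟩, hp⟩ := hk1
    have hpk := χ.injOn p4 hk2 hp
    rw [← hpk]
    exact hno p p1 p2 p3 (by rw [hpk]; exact hk3)
  choose p p1 p2 p3 p4 p5 using hex
  refine ⟨fun n ↦ (p n).2, fun n h ↦ p5 n ?_, ?_, fun n ↦
    ⟨p3 n, (K.mul_mem_cancel_left (hFK _)).1 (p4 n)⟩⟩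
  · rw [show (p n).2 = 0 from h, map_zero, add_zero, χ.left_inv h1, mul_one]
    exact p1 n
  · exact tendsto_zero_iff_norm_tendsto_zero.2 (squeeze_zero (fun n ↦ norm_nonneg _)
      (fun n ↦ (p2 n).le) tendsto_one_div_add_atTop_nhds_zero_nat)

variable [FiniteDimensional ℝ E] [T2Space G]

/-- By compactness of the unit sphere, the directions `w n / ‖w n‖` subconverge to a unit vector
`u`; the limit criterion applies with `τ = ‖w n‖`. -/
theorem exists_oneParam_mem_of_seq {W : Type*} [NormedAddCommGroup W] [NormedSpace ℝ W]
    [FiniteDimensional ℝ W] (B : W →L[ℝ] E) {K : Subgroup G} (hKc : IsClosed (K : Set G))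
    {w : ℕ → W} (hw0 : ∀ n, w n ≠ 0) (hw : Tendsto w atTop (𝓝 0))
    (hwt : ∀ n, extChartAt I (1 : G) 1 + B (w n) ∈ (extChartAt I (1 : G)).target)
    (hwK : ∀ n, (extChartAt I (1 : G)).symm (extChartAt I (1 : G) 1 + B (w n)) ∈ K) :
    ∃ u ≠ 0, ∀ t, oneParam I (B u : GroupLieAlgebra I G) t ∈ K := by
  have h1 : (1 : G) ∈ (extChartAt I (1 : G)).source := mem_extChartAt_source _
  have hχs := continuousAt_extChartAt_symm (I := I) (1 : G)
  have hlim := fun h hh h2 τ h3 h4 (w : E) h5 ↦ oneParam_mem_of_tendsto (I := I) (G := G) hKc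
    (h := h) hh h2 (w := w) (τ := τ) h3 h4 h5
  generalize extChartAt I (1 : G) = χ at *
  have hsph : ∀ n, ‖w n‖⁻¹ • w n ∈ Metric.sphere (0 : W) 1 := fun n ↦ by
    rw [mem_sphere_zero_iff_norm, norm_smul, norm_inv, norm_norm,
      inv_mul_cancel₀ (norm_ne_zero_iff.2 (hw0 n))]
  obtain ⟨u, hu, φ, hφ, hφu⟩ := (isCompact_sphere _ _).tendsto_subseq hsph
  have hφw := hw.comp hφ.tendsto_atTop
  refine ⟨u, fun hu0 ↦ ?_, hlim (fun n ↦ χ.symm (χ 1 + B (w (φ n)))) (fun n ↦ hwK _) ?_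
    (fun n ↦ ‖w (φ n)‖) (fun n ↦ norm_pos_iff.2 (hw0 _)) (by simpa using hφw.norm) (B u) ?_⟩
  · rw [hu0, mem_sphere_zero_iff_norm, norm_zero] at hu
    exact zero_ne_one hu
  · have h2 := (B.continuous.tendsto 0).comp hφw
    rw [map_zero] at h2
    have h3 := h2.const_add (χ 1)
    rw [add_zero] at h3
    have h4 := hχs.tendsto.comp h3
    rw [χ.left_inv h1] at h4
    exact h4
  · refine Tendsto.congr (fun n ↦ ?_) ((B.continuous.tendsto u).comp hφu)
    rw [χ.right_inv (hwt _), add_sub_cancel_left, Function.comp_apply, Function.comp_apply,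
      map_smul]

/-- Otherwise elements of `K` would approach `1` along the complement of `𝔨`, and their limit
direction would be a nonzero vector of the complement that belongs to `𝔨`. -/
theorem nhdsWithin_le_map_lieExp (K : Subgroup G) (hK : ∀ x ∈ K, ∀ y ∈ K, x * y = y * x)
    (hKc : IsClosed (K : Set G)) :
    𝓝[(K : Set G)] 1 ≤
      map (fun w : oneParamSubmodule I K hK ↦ lieExp (G := G) I (w : E)) (𝓝 0) := by
  have hle : Module.finrank ℝ (oneParamSubmodule I K hK) ≤ Module.finrank ℝ E :=
    Submodule.finrank_le _
  obtain ⟨B, T, hT⟩ := exists_continuousLinearEquiv_of_injective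
    (F := EuclideanSpace ℝ (Fin (Module.finrank ℝ E - Module.finrank ℝ (oneParamSubmodule I K hK))))
    (by simp [hle]) (oneParamSubmodule I K hK).subtypeL Subtype.val_injective
  intro S hS
  by_contra hcon
  obtain ⟨w, hw0, hw, hw'⟩ := exists_seq_complement (isImmersiveHom_lieExp (I := I) K hK)
    (hasMFDerivAt_lieExp_oneParamSubmodule K hK) B T hT K (lieExp_mem K hK) hS hcon
  obtain ⟨u, hu, hBu⟩ := exists_oneParam_mem_of_seq B hKc hw0 hw (fun n ↦ (hw' n).1)
    (fun n ↦ (hw' n).2)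
  have hTu : T (⟨B u, hBu⟩, 0) = T (0, u) := by simp [hT]
  exact hu (congrArg Prod.snd (T.injective hTu)).symm

end OpenMapping

/-! ### Periods, and the image of a line -/

section Periods

variable {V : Type*} [NormedAddCommGroup V] [NormedSpace ℝ V]
  {E : Type*} [NormedAddCommGroup E] [NormedSpace ℝ E]
  {H : Type*} [TopologicalSpace H] {I : ModelWithCorners ℝ E H}
  {G : Type*} [TopologicalSpace G] [ChartedSpace H G] [Group G]

namespace IsImmersiveHom

variable {F : V → G}

/-- The kernel of a smooth homomorphism from a vector space, as a `ℤ`-submodule. -/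
def periods (hF : IsImmersiveHom I F) : Submodule ℤ V :=
  AddSubgroup.toIntSubmodule
    { carrier := {x | F x = 1}
      add_mem' := fun {x y} (hx : F x = 1) (hy : F y = 1) ↦
        show F (x + y) = 1 by rw [hF.map_add, hx, hy, mul_one]
      zero_mem' := hF.map_zero
      neg_mem' := fun {x} (hx : F x = 1) ↦ show F (-x) = 1 by rw [hF.map_neg, hx, inv_one] }

theorem mem_periods (hF : IsImmersiveHom I F) {x : V} : x ∈ hF.periods ↔ F x = 1 := Iff.rfl

theorem discreteTopology_periods [FiniteDimensional ℝ V] (hF : IsImmersiveHom I F) :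
    DiscreteTopology hF.periods := by
  have h := hF.eventually_ne_one
  rw [eventually_nhdsWithin_iff] at h
  have h2 : {x : hF.periods | (x : V) ∈ ({0}ᶜ : Set V) → F x ≠ 1} ∈ 𝓝 (0 : hF.periods) :=
    (continuous_subtype_val.tendsto (0 : hF.periods)) h
  refine discreteTopology_iff_isOpen_singleton_zero.2 (isOpen_singleton_iff_nhds_eq_pure _ |>.2 ?_)
  refine le_antisymm (le_pure_iff.2 (mem_of_superset h2 fun x hx ↦ ?_)) (pure_le_nhds _)
  by_contra hx0
  exact hx (fun h0 ↦ hx0 (Subtype.ext h0)) x.2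

theorem nhdsWithin_le_map [IsTopologicalGroup G] (hF : IsImmersiveHom I F) {K : Subgroup G}
    (hFK : ∀ v, F v ∈ K) (hK : 𝓝[(K : Set G)] 1 ≤ map F (𝓝 0)) (v : V) :
    𝓝[(K : Set G)] (F v) ≤ map F (𝓝 v) := by
  intro S hS
  have hv : Tendsto (fun w ↦ v + w) (𝓝 0) (𝓝 v) := by
    have : Continuous (fun w ↦ v + w) := by fun_prop
    simpa using this.tendsto 0
  have h1 : {x | F v * x ∈ S} ∈ map F (𝓝 0) := by
    have h2 := hv (mem_map.1 hS)
    refine mem_map.2 (mem_of_superset (mem_map.1 h2) fun w hw ↦ ?_)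
    have h3 : F (v + w) ∈ S := hw
    rwa [hF.map_add] at h3
  have h4 : Tendsto (fun x ↦ (F v)⁻¹ * x) (𝓝[(K : Set G)] (F v)) (𝓝[(K : Set G)] 1) := by
    refine tendsto_nhdsWithin_iff.2 ⟨?_, ?_⟩
    · have : Continuous (fun x ↦ (F v)⁻¹ * x) := by fun_prop
      simpa using (this.tendsto (F v)).mono_left nhdsWithin_le_nhds
    · filter_upwards [self_mem_nhdsWithin] with x hx using K.mul_mem (K.inv_mem (hFK v)) hx
  refine mem_of_superset (h4 (hK h1)) fun x hx ↦ ?_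
  simpa using hx

/-- The range contains a neighbourhood of `1` in `K`; by density some point of the line carries `k`
into it by translation. -/
theorem range_eq_of_nhdsWithin_le_map [IsTopologicalGroup G] (hF : IsImmersiveHom I F)
    {K : Subgroup G} (hFK : ∀ v, F v ∈ K) (hK : 𝓝[(K : Set G)] 1 ≤ map F (𝓝 0)) {u : V}
    (hu : (K : Set G) ⊆ closure (range fun s : ℝ ↦ F (s • u))) : range F = K := by
  refine Subset.antisymm (range_subset_iff.2 hFK) fun k hk ↦ ?_
  have h1 : range F ∈ 𝓝[(K : Set G)] 1 := hK range_mem_map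
  obtain ⟨O, hO, hO1, hOK⟩ := mem_nhdsWithin.1 h1
  have hc : Continuous fun x : G ↦ x⁻¹ * k := by fun_prop
  obtain ⟨_, hx, s, rfl⟩ := mem_closure_iff.1 (hu hk) _ (hO.preimage hc) (by simpa using hO1)
  obtain ⟨v, hv⟩ := hOK ⟨hx, K.mul_mem (K.inv_mem (hFK _)) hk⟩
  exact ⟨s • u + v, by rw [hF.map_add, hv, mul_inv_cancel_left]⟩

section Line

variable (hF : IsImmersiveHom I F) {K : Subgroup G}
  (hmap : ∀ v, 𝓝[(K : Set G)] (F v) ≤ map F (𝓝 v)) {u : V} (hu : ∀ s : ℝ, F (s • u) ∈ K)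
  {f : V →L[ℝ] ℝ} (hf : ∀ x ∈ hF.periods, f x = 0)
include hF hmap hu hf

/-- `f` descends to `K`. If `f u = 0`, it would vanish on the dense line, which must meet the image
of `{f ≠ 0}`. -/
theorem apply_ne_zero_of_periods_le_ker (hrange : range F = K)
    (hdense : (K : Set G) ⊆ closure (range fun s : ℝ ↦ F (s • u))) (hf0 : f ≠ 0) : f u ≠ 0 := by
  intro hfu
  obtain ⟨v, hv⟩ : ∃ v, f v ≠ 0 := by
    by_contra! h
    exact hf0 (ContinuousLinearMap.ext h)
  have h1 : {x | f x ≠ 0} ∈ 𝓝 v := f.continuous.continuousAt.eventually_ne hv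
  obtain ⟨O, hO, hOv, hOK⟩ := mem_nhdsWithin.1 (hmap v (image_mem_map h1))
  have hvK : F v ∈ (K : Set G) := hrange ▸ mem_range_self v
  obtain ⟨_, hx, s, rfl⟩ := mem_closure_iff.1 (hdense hvK) _ hO hOv
  obtain ⟨x, hx0, hx1⟩ := hOK ⟨hx, hu s⟩
  have h2 := hf _ (hF.eq_iff.1 hx1)
  rw [_root_.map_sub, map_smul, hfu, smul_zero, sub_zero] at h2
  exact hx0 h2

/-- If `F x = F (s • u)`, then `f x = s * f u`, so `f / f u` recovers the parameter continuously. -/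
theorem nhdsWithin_range_le_map_line (hfu : f u ≠ 0) (v : V) :
    𝓝[range fun s : ℝ ↦ F (s • u)] (F v) ≤ map (fun s : ℝ ↦ F (s • u)) (𝓝 (f v / f u)) := by
  intro S hS
  have h1 : Tendsto (fun x ↦ f x / f u) (𝓝 v) (𝓝 (f v / f u)) :=
    (f.continuous.div_const _).tendsto v
  have h2 := (nhdsWithin_mono (F v) (range_subset_iff.2 hu)).trans (hmap v)
    (image_mem_map (h1 (mem_map.1 hS)))
  filter_upwards [h2, self_mem_nhdsWithin] with k ⟨x, hx, hxk⟩ ⟨s, hs⟩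
  have h3 := hf _ (hF.eq_iff.1 (hxk.trans hs.symm))
  rw [_root_.map_sub, map_smul, sub_eq_zero] at h3
  have h4 : F ((f x / f u) • u) ∈ S := hx
  rwa [h3, smul_eq_mul, mul_div_cancel_right₀ _ hfu, show F (s • u) = k from hs] at h4

theorem isClosed_range_line [T2Space G] (hrange : range F = K)
    (hdense : (K : Set G) = closure (range fun s : ℝ ↦ F (s • u))) (hfu : f u ≠ 0) :
    IsClosed (range fun s : ℝ ↦ F (s • u)) := by
  refine isClosed_of_closure_subset fun k hk ↦ ?_
  have hkK := hk
  rw [← hdense, ← hrange] at hkK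
  obtain ⟨v, rfl⟩ := hkK
  have := mem_closure_iff_nhdsWithin_neBot.1 hk
  have hc : Continuous fun s : ℝ ↦ F (s • u) := hF.continuous.comp (by fun_prop)
  -- Points of the line near `F v` have parameters near `f v / f u`, so they also converge to the
  -- point with that parameter; limits are unique.
  refine ⟨f v / f u, eq_of_nhds_neBot (this.mono (le_inf ?_ nhdsWithin_le_nhds))⟩
  exact (nhdsWithin_range_le_map_line hF hmap hu hf hfu v).trans (hc.tendsto _)

theorem isEmbedding_line (hfu : f u ≠ 0) : IsEmbedding fun s : ℝ ↦ F (s • u) := by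
  have hinj : Function.Injective fun s : ℝ ↦ F (s • u) := fun s t hst ↦ by
    have h3 := hf _ (hF.eq_iff.1 hst)
    rw [← sub_smul, map_smul, smul_eq_mul] at h3
    exact sub_eq_zero.1 ((mul_eq_zero.1 h3).resolve_right hfu)
  have hc : Continuous fun s : ℝ ↦ F (s • u) := hF.continuous.comp (by fun_prop)
  refine ⟨isInducing_iff_nhds.2 fun s ↦ le_antisymm (hc.tendsto s).le_comap ?_, hinj⟩
  have h := nhdsWithin_range_le_map_line hF hmap hu hf hfu (s • u)
  rw [map_smul, smul_eq_mul, mul_div_cancel_right₀ _ hfu] at h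
  rw [← comap_map (f := 𝓝 s) hinj]
  rw [← comap_nhdsWithin_range]
  exact comap_mono h

end Line

theorem countable_periods [FiniteDimensional ℝ V] (hF : IsImmersiveHom I F)
    (hspan : Submodule.span ℝ (hF.periods : Set V) = ⊤) : Countable hF.periods := by
  have := hF.discreteTopology_periods
  have : IsZLattice ℝ hF.periods := ⟨hspan⟩
  infer_instance

/-- A nonzero form `g` with `g u = 0` would map the countable group of periods onto `ℝ`, since every
`v` would be a multiple of `u` plus a period. -/
theorem range_line_ne_range [FiniteDimensional ℝ V] (hF : IsImmersiveHom I F)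
    (hspan : Submodule.span ℝ (hF.periods : Set V) = ⊤) (hV : 2 ≤ Module.finrank ℝ V) (u : V) :
    range (fun s : ℝ ↦ F (s • u)) ≠ range F := by
  intro heq
  have hlt : Submodule.span ℝ {u} < ⊤ := by
    refine lt_top_iff_ne_top.2 fun h ↦ ?_
    have h1 := finrank_span_le_card (R := ℝ) {u}
    rw [h, finrank_top, toFinset_singleton, Finset.card_singleton] at h1
    omega
  obtain ⟨g, hg0, hg⟩ := Submodule.exists_le_ker_of_lt_top _ hlt
  have hgu : g u = 0 := hg (Submodule.mem_span_singleton_self u)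
  have := hF.countable_periods hspan
  have hsurj : Function.Surjective fun x : hF.periods ↦ g x := fun t ↦ by
    obtain ⟨v, rfl⟩ := LinearMap.surjective hg0 t
    obtain ⟨s, hs⟩ : F v ∈ range fun s : ℝ ↦ F (s • u) := heq ▸ mem_range_self v
    refine ⟨⟨v - s • u, hF.eq_iff.1 hs.symm⟩, ?_⟩
    simp [hgu]
  exact not_countable (α := ℝ) hsurj.countable

theorem comp_equiv {V' : Type*} [NormedAddCommGroup V'] [NormedSpace ℝ V']
    (hF : IsImmersiveHom I F) (e : V' ≃L[ℝ] V) : IsImmersiveHom I (F ∘ e) where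
  contMDiff := hF.contMDiff.comp e.contDiff.contMDiff
  map_add x y := by simp [hF.map_add]
  injective_mfderiv := by
    have h1 : HasMFDerivAt 𝓘(ℝ, V) I F (e 0) (mfderiv 𝓘(ℝ, V) I F 0) := by
      rw [_root_.map_zero]; exact (hF.contMDiff.mdifferentiable (by simp) 0).hasMFDerivAt
    have h2 := HasMFDerivAt.comp (f := e) (0 : V') h1 e.hasFDerivAt.hasMFDerivAt
    rw [h2.mfderiv]
    exact fun v w hvw ↦ e.injective (hF.injective_mfderiv hvw)

theorem exists_equiv_periods [FiniteDimensional ℝ V] (hF : IsImmersiveHom I F)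
    (hspan : Submodule.span ℝ (hF.periods : Set V) = ⊤) :
    ∃ e : (Fin (Module.finrank ℝ V) → ℝ) ≃L[ℝ] V,
      ∀ x, F (e x) = 1 ↔ ∀ i, Circle.exp (x i) = 1 := by
  have := hF.discreteTopology_periods
  have : IsZLattice ℝ hF.periods := ⟨hspan⟩
  have := ZLattice.module_free ℝ hF.periods
  have := ZLattice.module_finite ℝ hF.periods
  let b₀ := (Module.finBasisOfFinrankEq ℤ hF.periods (ZLattice.rank ℝ hF.periods))
  let b := b₀.ofZLatticeBasis ℝ hF.periods
  -- A `ℤ`-basis of the period lattice is rescaled, because `Circle.exp` has period `2π`.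
  have hπ : (2 * Real.pi)⁻¹ ≠ 0 := by positivity
  let e : (Fin (Module.finrank ℝ V) → ℝ) ≃L[ℝ] V :=
    ((LinearEquiv.smulOfNeZero ℝ _ _ hπ).trans b.equivFun.symm).toContinuousLinearEquiv
  refine ⟨e, fun x ↦ ?_⟩
  rw [← hF.mem_periods, ← b₀.ofZLatticeBasis_span ℝ, b.mem_span_iff_repr_mem ℤ]
  refine forall_congr' fun i ↦ ?_
  have hr : b.repr (e x) i = (2 * Real.pi)⁻¹ * x i := by
    have he : e x = b.equivFun.symm ((2 * Real.pi)⁻¹ • x) := rfl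
    rw [← b.equivFun_apply, he, LinearEquiv.apply_symm_apply, Pi.smul_apply, smul_eq_mul]
  rw [hr, Circle.exp_eq_one]
  refine exists_congr fun n ↦ ?_
  simp only [eq_intCast]
  rw [eq_inv_mul_iff_mul_eq₀ (by positivity), mul_comm, eq_comm]

end IsImmersiveHom

end Periods

/-! ### The three cases -/

section Classification

/-- The first isomorphism theorem, from an additive group to multiplicative ones. -/
theorem exists_monoidHom_of_ker {V T G : Type*} [AddCommGroup V] [Group T] [Group G] {q : V → T}
    (hq : ∀ x y, q (x + y) = q x * q y) (hq' : Function.Surjective q) {F : V → G}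
    (hF : ∀ x y, F (x + y) = F x * F y) (hker : ∀ x, F x = 1 ↔ q x = 1) :
    ∃ φ : T →* G, Function.Injective φ ∧ (∀ x, φ (q x) = F x) ∧ range φ = range F := by
  have key : ∀ x y, q x = q y ↔ F x = F y := by
    let a : Multiplicative V →* T := MonoidHom.mk' (fun x ↦ q x.toAdd) fun x y ↦ hq _ _
    let b : Multiplicative V →* G := MonoidHom.mk' (fun x ↦ F x.toAdd) fun x y ↦ hF _ _
    intro x y
    have h := (hker (x - y)).symm
    have ha : q (x - y) = q x / q y := map_div a (.ofAdd x) (.ofAdd y)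
    have hb : F (x - y) = F x / F y := map_div b (.ofAdd x) (.ofAdd y)
    rwa [ha, hb, div_eq_one, div_eq_one] at h
  have hs := Function.rightInverse_surjInv hq'
  let φ : T →* G := MonoidHom.mk' (fun c ↦ F (Function.surjInv hq' c)) fun c d ↦ by
    rw [← hF, ← key, hq, hs, hs, hs]
  have hφ : ∀ x, φ (q x) = F x := fun x ↦ (key _ _).1 (hs _)
  refine ⟨φ, fun c d hcd ↦ ?_, hφ, ?_⟩
  · rw [← hs c, ← hs d]
    exact (key _ _).2 hcd
  · rw [← (funext hφ : φ ∘ q = F), hq'.range_comp]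

variable {V : Type*} [NormedAddCommGroup V] [NormedSpace ℝ V] [FiniteDimensional ℝ V]
  {E : Type*} [NormedAddCommGroup E] [NormedSpace ℝ E] [FiniteDimensional ℝ E]
  {H : Type*} [TopologicalSpace H] {I : ModelWithCorners ℝ E H} [I.Boundaryless]
  {G : Type*} [TopologicalSpace G] [T2Space G] [ChartedSpace H G] [Group G] [LieGroup I ∞ G]

namespace IsImmersiveHom

theorem exists_circle_hom {F : ℝ → G} (hF : IsImmersiveHom I F)
    (hker : ∀ x, F x = 1 ↔ Circle.exp x = 1) :
    ∃ φ : Circle →* G, Manifold.IsSmoothEmbedding (𝓡 1) I ∞ φ ∧ (∀ x, φ (Circle.exp x) = F x) ∧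
      range φ = range F := by
  obtain ⟨φ, hφ, hφF, hr⟩ := exists_monoidHom_of_ker Circle.exp_add
    (fun c ↦ ⟨Complex.arg c, Circle.exp_arg c⟩) hF.map_add hker
  have hi := hF.isImmersion_circle hφF
  -- An injective continuous map from a compact space to a Hausdorff one is a closed embedding.
  exact ⟨φ, ⟨hi, (hi.contMDiff.continuous.isClosedEmbedding hφ).isEmbedding⟩, hφF, hr⟩

theorem exists_torus_hom {k : ℕ} {F : (Fin k → ℝ) → G} (hF : IsImmersiveHom I F)
    (hker : ∀ x, F x = 1 ↔ ∀ i, Circle.exp (x i) = 1) :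
    ∃ φ : (Fin k → Circle) →* G,
      Manifold.IsSmoothEmbedding (ModelWithCorners.pi fun _ : Fin k ↦ 𝓡 1) I ∞ φ ∧
      range φ = range F := by
  obtain ⟨φ, hφ, hφF, hr⟩ := exists_monoidHom_of_ker
    (q := fun (x : Fin k → ℝ) i ↦ Circle.exp (x i)) (fun x y ↦ funext fun i ↦ Circle.exp_add _ _)
    (fun c ↦ ⟨fun i ↦ Complex.arg (c i), funext fun i ↦ Circle.exp_arg _⟩) hF.map_add
    (fun x ↦ (hker x).trans funext_iff.symm)
  have hi := hF.isImmersion_torus hφF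
  exact ⟨φ, ⟨hi, (hi.contMDiff.continuous.isClosedEmbedding hφ).isEmbedding⟩, hr⟩

theorem isClosedCircle_line {F : (Fin 1 → ℝ) → G} (hF : IsImmersiveHom I F)
    (hker : ∀ x, F x = 1 ↔ ∀ i, Circle.exp (x i) = 1) {u : Fin 1 → ℝ} (hu : u ≠ 0) :
    IsClosedCircle I fun s : ℝ ↦ F (s • u) := by
  let c := (ContinuousLinearEquiv.funUnique (Fin 1) ℝ ℝ).symm
  obtain ⟨φ, hφ, hφF, -⟩ := (hF.comp_equiv c).exists_circle_hom fun x ↦ by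
    rw [Function.comp_apply, hker, Fin.forall_fin_one]
    rfl
  have ha : u 0 ≠ 0 := fun h ↦ hu (funext fun i ↦ by rw [Subsingleton.elim i 0, h]; rfl)
  -- The line runs through `F` at speed `u 0`, so its projection to the circle is `s ↦ Circle.exp (s
  -- * u 0)`.
  let m := ContinuousLinearEquiv.unitsEquivAut ℝ (Units.mk0 (u 0) ha)
  have hm : ∀ s, φ (Circle.exp (m s)) = F (s • u) := fun s ↦ by
    rw [hφF, Function.comp_apply]
    congr 1
    ext i
    rw [Subsingleton.elim i 0]
    rfl
  have hr : range φ = range fun s : ℝ ↦ F (s • u) := by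
    rw [← (funext hm : (fun s ↦ φ (Circle.exp (m s))) = _)]
    have hs : Function.Surjective fun s ↦ Circle.exp (m s) :=
      Function.Surjective.comp (g := Circle.exp) (fun c ↦ ⟨Complex.arg c, Circle.exp_arg c⟩)
        m.surjective
    exact (hs.range_comp φ).symm
  refine ⟨hr ▸ (isCompact_range hφ.isImmersion.contMDiff.continuous).isClosed, φ,
    Circle.exp ∘ m, hφ, hr, ?_, fun s ↦ ?_, fun s ↦ (hm s).symm⟩
  · exact Circle.isCoveringMap_exp.comp_homeomorph m.toHomeomorph
  · exact (m.toDiffeomorph.isLocalDiffeomorph s).comp _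
      _ (Circle.isLocalDiffeomorph_exp (m s))

/-- A one-parameter subgroup of a closed abelian subgroup in which it is dense is a closed line,
a closed circle, or dense in a torus. -/
theorem line_trichotomy {F : V → G} (hF : IsImmersiveHom I F) {K : Subgroup G}
    (hFK : ∀ v, F v ∈ K) (hK : 𝓝[(K : Set G)] 1 ≤ map F (𝓝 0)) {u : V} (hu : u ≠ 0)
    (hdense : (K : Set G) = closure (range fun s : ℝ ↦ F (s • u)))
    (hψ : IsImmersiveHom I fun s : ℝ ↦ F (s • u)) :
    IsClosedLine I (fun s : ℝ ↦ F (s • u)) ∨ IsClosedCircle I (fun s : ℝ ↦ F (s • u)) ∨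
      HasTorusClosure I (fun s : ℝ ↦ F (s • u)) := by
  have := topologicalGroup_of_lieGroup I ∞ (G := G)
  have hrange : range F = K := hF.range_eq_of_nhdsWithin_le_map hFK hK hdense.subset
  have hmap := hF.nhdsWithin_le_map hFK hK
  -- Either the periods form a lattice and `K` is compact, or a nonzero linear form vanishes on all
  -- of them.
  by_cases hspan : Submodule.span ℝ (hF.periods : Set V) = ⊤
  · right
    obtain ⟨e, he⟩ := hF.exists_equiv_periods hspan
    have hpos : 1 ≤ Module.finrank ℝ V := Module.finrank_pos_iff_exists_ne_zero.2 ⟨u, hu⟩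
    rcases hpos.eq_or_lt with h1 | h1
    · left
      generalize Module.finrank ℝ V = k at e he h1
      subst h1
      have h2 := (hF.comp_equiv e).isClosedCircle_line he
        ((map_ne_zero_iff e.symm e.symm.injective).2 hu)
      simpa only [Function.comp_apply, map_smul, e.apply_symm_apply] using h2
    · right
      obtain ⟨φ, hφ, hr⟩ := (hF.comp_equiv e).exists_torus_hom he
      rw [e.surjective.range_comp, hrange, hdense] at hr
      -- A closed image would equal `K`, which the countability argument forbids in dimension at
      -- least two.
      refine ⟨fun hc ↦ hF.range_line_ne_range hspan h1 u ?_, _, φ, h1, hφ, hr⟩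
      rw [hrange, hdense, hc.closure_eq]
  · left
    obtain ⟨f, hf0, hf⟩ := Submodule.exists_le_ker_of_lt_top _ (lt_top_iff_ne_top.2 hspan)
    let f' : V →L[ℝ] ℝ := LinearMap.toContinuousLinearMap f
    have hf' : ∀ x ∈ hF.periods, f' x = 0 := fun x hx ↦ hf (Submodule.subset_span hx)
    have hf0' : f' ≠ 0 := fun h ↦ hf0 (LinearMap.ext fun x ↦ DFunLike.congr_fun h x)
    have hu' : ∀ s : ℝ, F (s • u) ∈ K := fun s ↦ hFK _
    have hfu := hF.apply_ne_zero_of_periods_le_ker hmap hu' hf' hrange hdense.subset hf0'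
    exact ⟨hF.isClosed_range_line hmap hu' hf' hrange hdense hfu, hψ.isImmersion_self,
      hF.isEmbedding_line hmap hu' hf' hfu⟩

end IsImmersiveHom

theorem isImmersiveHom_oneParam {U : GroupLieAlgebra I G} (hU : U ≠ 0) :
    IsImmersiveHom I (oneParam I U) where
  contMDiff := contMDiff_oneParam U
  map_add := oneParam_add U
  injective_mfderiv := by
    rw [(hasMFDerivAt_oneParam_zero U).mfderiv]
    exact smul_left_injective ℝ (M := E) hU

variable (I) in
/-- The image of a one-parameter group. -/
def oneParamSubgroup (U : GroupLieAlgebra I G) : Subgroup G where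
  carrier := range (oneParam I U)
  mul_mem' := by
    rintro _ _ ⟨s, rfl⟩ ⟨t, rfl⟩
    exact ⟨s + t, oneParam_add U s t⟩
  one_mem' := ⟨0, oneParam_zero U⟩
  inv_mem' := by
    rintro _ ⟨s, rfl⟩
    exact ⟨-s, eq_inv_of_mul_eq_one_left (by rw [← oneParam_add, neg_add_cancel, oneParam_zero])⟩

theorem oneParamSubgroup_comm (U : GroupLieAlgebra I G) :
    ∀ x ∈ oneParamSubgroup I U, ∀ y ∈ oneParamSubgroup I U, x * y = y * x := by
  rintro _ ⟨s, rfl⟩ _ ⟨t, rfl⟩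
  rw [← oneParam_add, ← oneParam_add, add_comm]

theorem oneParam_trichotomy {U : GroupLieAlgebra I G} (hU : U ≠ 0) :
    IsClosedLine I (oneParam I U) ∨ IsClosedCircle I (oneParam I U) ∨
      HasTorusClosure I (oneParam I U) := by
  have := topologicalGroup_of_lieGroup I ∞ (G := G)
  let K := (oneParamSubgroup I U).topologicalClosure
  have hK : ∀ x ∈ K, ∀ y ∈ K, x * y = y * x := by
    let := (oneParamSubgroup I U).commGroupTopologicalClosure fun x y ↦
      Subtype.ext (oneParamSubgroup_comm U _ x.2 _ y.2)
    exact fun x hx y hy ↦ congrArg Subtype.val (mul_comm (⟨x, hx⟩ : K) ⟨y, hy⟩)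
  have hKc : IsClosed (K : Set G) := Subgroup.isClosed_topologicalClosure _
  have hUK : ∀ t, oneParam I U t ∈ K := fun t ↦
    Subgroup.le_topologicalClosure _ (mem_range_self (f := oneParam I U) t)
  let u : oneParamSubmodule I K hK := ⟨U, hUK⟩
  exact (isImmersiveHom_lieExp (I := I) K hK).line_trichotomy (u := u) (lieExp_mem K hK)
    (nhdsWithin_le_map_lieExp K hK hKc) (fun h ↦ hU (congrArg Subtype.val h)) rfl
    (isImmersiveHom_oneParam hU)

-- The circle is compact, whereas an embedded line is not.
omit [FiniteDimensional ℝ E] [I.Boundaryless] [T2Space G] [LieGroup I ∞ G] in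
theorem not_isClosedLine_and_isClosedCircle {ψ : ℝ → G} :
    ¬ (IsClosedLine I ψ ∧ IsClosedCircle I ψ) := by
  rintro ⟨⟨-, hψ⟩, -, φ, p, hφ, hr, -⟩
  have h1 : IsCompact (range ψ) := hr ▸ isCompact_range hφ.isEmbedding.continuous
  rw [← image_univ] at h1
  exact noncompact_univ ℝ (hψ.isEmbedding.isCompact_iff.2 h1)

end Classification

end

theorem mainTheorem8
    {E : Type*} [NormedAddCommGroup E] [NormedSpace ℝ E] [FiniteDimensional ℝ E]
    {H : Type*} [TopologicalSpace H] (I : ModelWithCorners ℝ E H) [I.Boundaryless]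
    {G : Type*} [TopologicalSpace G] [T2Space G] [ChartedSpace H G] [Group G] [LieGroup I ∞ G]
    (U : GroupLieAlgebra I G) (hU : U ≠ 0) :
    -- the one-parameter group is a homomorphism, and its image is a connected abelian subgroup
    (∀ s t : ℝ, oneParam I U (s + t) = oneParam I U s * oneParam I U t) ∧
    (∃ A : Subgroup G, (A : Set G) = Set.range (oneParam I U) ∧
      IsConnected (A : Set G) ∧ ∀ x ∈ A, ∀ y ∈ A, x * y = y * x) ∧
    -- one of the three cases holds, and no two of them hold together
    (IsClosedLine I (oneParam I U) ∨ IsClosedCircle I (oneParam I U) ∨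
      HasTorusClosure I (oneParam I U)) ∧
    ¬ (IsClosedLine I (oneParam I U) ∧ IsClosedCircle I (oneParam I U)) ∧
    ¬ (IsClosedLine I (oneParam I U) ∧ HasTorusClosure I (oneParam I U)) ∧
    ¬ (IsClosedCircle I (oneParam I U) ∧ HasTorusClosure I (oneParam I U)) :=
  ⟨oneParam_add U, ⟨oneParamSubgroup I U, rfl, isConnected_range (continuous_oneParam U),
    oneParamSubgroup_comm U⟩, oneParam_trichotomy hU, not_isClosedLine_and_isClosedCircle,
    fun h ↦ h.2.1 h.1.1, fun h ↦ h.2.1 h.1.1⟩
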